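/- **Setting.** A network $\mathcal N$ in $\mathbb S^2$ is a finite family of smooth regular curves $\gamma^j:[0,1]\to\mathbb S^2$ without self-intersection, each with a chosen continuous unit normal field $\nu^j$ in $T\mathbb S^2$, and with disjoint point sets $\mathcal P$ (interior end points) and $\mathcal Q$ (boundary end points) whose union is the set of all end points of the curves; different curves meet only at end points, and the exterior unit tangents of the curves ending at a common point are pairwise different. For a set $S$ of points let $V(S)=\bigoplus_{p\in S}\mathbb R^{j_p}$ with the Euclidean inner product, where $j_p$ is the number of curves ending at $p$; let $V_1(S)$ be the set of elements of $V(S)$ that at each $p\in S$ have the form $(X\cdot\nu^j)_j$ with $X\in T_p\mathbb S^2$, and $V_2(S)=V_1(S)^\perp$. Functions on $\mathcal N$ are tuples of functions on the curves. Let $d\in C^\infty(\mathcal N)$, $Lu=\Delta u+du$ with $\Delta$ the second arc-length derivative on each curve (the second variation of length of a stationary network is the case $d=1$), and $\mathcal L(u,v)=\int_{\mathcal N}\nabla u\cdot\nabla v-duv$. Let $W^{1,2}_{0,1}(\mathcal N)$ be the space of $W^{1,2}$ functions with $u|_{\mathcal P}\in V_1(\mathcal P)$ and $u|_{\mathcal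 Q}=0$. The index $\mathrm{Ind}(\mathcal N)$ is the maximal dimension of a subspace of $W^{1,2}_{0,1}(\mathcal N)$ on which $\mathcal L$ is negative definite. Let $\mathcal J_0^0(\mathcal N)$ be the space of smooth $u$ with $Lu=0$, $u=0$ on $\mathcal Q$, $u\in V_1(\mathcal P)$ and $\partial u/\partial\tau\in V_2(\mathcal P)$, where $\tau$ is the exterior direction. For $S\subset\mathcal Q$ let $D_\tau\mathcal J_0^0(S)=\{\partial u/\partial\tau|_S: u\in\mathcal J_0^0(\mathcal N)\}\subset V(S)$. The Dirichlet-to-Neumann map $T:(D_\tau\mathcal J_0^0(S))^\perp\to(D_\tau\mathcal J_0^0(S))^\perp$ sends $g$ to $\partial u/\partial\tau|_S$, where $u$ is any smooth function with $Lu=0$, $u=g$ on $S$, $u=0$ on $\mathcal Q\setminus S$, $u\in V_1(\mathcal P)$, $\partial u/\partial\tau\in V_2(\mathcal P)$ and $\partial u/\partial\tau|_S\perp D_\tau\mathcal J_0^0(S)$. **Partition.** A partition of $\mathcal N$ distributes its curves among networks $\mathcal N_1,\dots,\mathcal N_l$, with interior and boundary end point sets $\mathcal P_i$ and $\mathcal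 Q_i$, such that $\mathcal P=\mathring{\mathcal P}\sqcup\overline{\mathcal P}$, $\mathcal Q_i=\tilde{\mathcal Q}_i\sqcup\overline{\mathcal Q}_i$, $\mathring{\mathcal P}=\bigsqcup_i\mathcal P_i$, $\overline{\mathcal P}=\bigcup_i\tilde{\mathcal Q}_i$ and $\mathcal Q=\bigcup_i\overline{\mathcal Q}_i$. Identify $V(\overline{\mathcal P})=\bigoplus_iV(\tilde{\mathcal Q}_i)$. Let $T_i$ be the Dirichlet-to-Neumann map of $\mathcal N_i$ on $\tilde{\mathcal Q}_i$, $\hat T=\bigoplus_iT_i$, and $D=\bigoplus_iD_\tau\mathcal J_0^0(\tilde{\mathcal Q}_i)\subset V(\overline{\mathcal P})$, with $\mathcal J_0^0$ taken on $\mathcal N_i$. Put $\overline V_1=D^\perp\cap V_1(\overline{\mathcal P})$ and let $\overline T:\overline V_1\to\overline V_1$ be $\hat T$ followed by the orthogonal projection onto $\overline V_1$; $\mathrm{Ind}(\overline T)$ is the dimension of the sum of its eigenspaces with negative eigenvalues. Let $F_2=D\cap V_2(\overline{\mathcal P})$, and let $F_1$ be the orthogonal complement of $F_2$ in $D$. **Theorem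 (index theorem for networks).** Let $\mathcal N$ be a network with a partition $\{\mathcal N_i\}_{i=1,\dots,l}$ and let $d\in C^\infty(\mathcal N)$. Then the Dirichlet-to-Neumann maps $T_i$ are well defined (every $g\in(D_\tau\mathcal J_0^0(\tilde{\mathcal Q}_i))^\perp$ has an extension $u$ as above, and $\partial u/\partial\tau|_{\tilde{\mathcal Q}_i}$ does not depend on its choice), $\mathrm{Ind}(\mathcal N)$ is finite, and $$\mathrm{Ind}(\mathcal N)=\sum_{i=1}^l\mathrm{Ind}(\mathcal N_i)+\mathrm{Ind}(\overline T)+\dim F_1 .$$ Moreover, if $D=(D\cap V_1(\overline{\mathcal P}))\oplus(D\cap V_2(\overline{\mathcal P}))$, then $F_1=D\cap V_1(\overline{\mathcal P})$ and $\overline T(g)=\mathrm{Proj}_{V_1(\overline{\mathcal P})}\hat T(g)$ for all $g\in\overline V_1$. -/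

import Mathlib

open Set MeasureTheory
open scoped ContDiff

noncomputable section

/-- The ambient space `ℝ³` of the unit sphere. -/
abbrev E3 : Type := EuclideanSpace ℝ (Fin 3)

/-- A smooth regular curve `γ : [0,1] → 𝕊²` without self-intersection, together with a chosen
(continuous) unit normal field `ν` along it, tangent to the sphere. Values outside `[0,1]` are
irrelevant. -/
structure SphereCurve where
  toFun : ℝ → E3
  normal : ℝ → E3
  smooth : ContDiffOn ℝ ∞ toFun (Icc 0 1)
  mem_sphere : ∀ t ∈ Icc (0 : ℝ) 1, ‖toFun t‖ = 1
  regular : ∀ t ∈ Icc (0 : ℝ) 1, derivWithin toFun (Icc 0 1) t ≠ 0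
  injOn : InjOn toFun (Icc 0 1)
  normal_continuous : ContinuousOn normal (Icc 0 1)
  normal_unit : ∀ t ∈ Icc (0 : ℝ) 1, ‖normal t‖ = 1
  normal_tangent_sphere : ∀ t ∈ Icc (0 : ℝ) 1, inner ℝ (normal t) (toFun t) = 0
  normal_perp : ∀ t ∈ Icc (0 : ℝ) 1,
    inner ℝ (normal t) (derivWithin toFun (Icc 0 1) t) = 0

/-- The parameter of an end of a curve: `false` is the initial end, `true` the final end. -/
def endParam (b : Bool) : unitInterval := if b then 1 else 0

/-- The sign of the exterior direction at an end, relative to the parametrization. -/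
def endSign (b : Bool) : ℝ := if b then 1 else -1

/-- A function on `[0,1]`, extended to `ℝ` by its end values (so that derivatives can be taken). -/
def ext01 (u : unitInterval → ℝ) : ℝ → ℝ := IccExtend zero_le_one u

namespace SphereCurve

/-- The speed `|γ'|`. -/
def speed (γ : SphereCurve) (t : ℝ) : ℝ := ‖derivWithin γ.toFun (Icc 0 1) t‖

/-- The end point of the curve at the end `b`. -/
def endpoint (γ : SphereCurve) (b : Bool) : E3 := γ.toFun (endParam b)

/-- The exterior unit tangent vector `τ` of the curve at the end `b`. -/
def outerTangent (γ : SphereCurve) (b : Bool) : E3 :=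
  (endSign b * (γ.speed (endParam b))⁻¹) • derivWithin γ.toFun (Icc 0 1) (endParam b)

/-- The derivative with respect to arc length of a function on the curve. -/
def arcDeriv (γ : SphereCurve) (f : ℝ → ℝ) (t : ℝ) : ℝ :=
  derivWithin f (Icc 0 1) t / γ.speed t

theorem arcDeriv_add (γ : SphereCurve) {f g : ℝ → ℝ} {t : ℝ}
    (hf : DifferentiableWithinAt ℝ f (Icc 0 1) t) (hg : DifferentiableWithinAt ℝ g (Icc 0 1) t) :
    γ.arcDeriv (f + g) t = γ.arcDeriv f t + γ.arcDeriv g t := by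
  simp only [arcDeriv, derivWithin_add hf hg, add_div]

theorem arcDeriv_smul (γ : SphereCurve) {f : ℝ → ℝ} {t : ℝ} (c : ℝ) :
    γ.arcDeriv (c • f) t = c * γ.arcDeriv f t := by
  simp only [arcDeriv, derivWithin_const_smul_field, smul_eq_mul, mul_div_assoc]

theorem arcDeriv_congr (γ : SphereCurve) {f g : ℝ → ℝ} {t : ℝ} (h : EqOn f g (Icc 0 1))
    (ht : t ∈ Icc (0 : ℝ) 1) : γ.arcDeriv f t = γ.arcDeriv g t := by
  simp only [arcDeriv, derivWithin_congr h (h ht)]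

theorem arcDeriv_contDiffOn (γ : SphereCurve) {f : ℝ → ℝ} (hf : ContDiffOn ℝ ∞ f (Icc 0 1)) :
    ContDiffOn ℝ ∞ (γ.arcDeriv f) (Icc 0 1) := by
  have hu : UniqueDiffOn ℝ (Icc (0 : ℝ) 1) := uniqueDiffOn_Icc_zero_one
  refine ContDiffOn.div (hf.derivWithin hu (by simp)) ?_ ?_
  · exact (γ.smooth.derivWithin hu (by simp)).norm ℝ γ.regular
  · exact fun t ht => norm_ne_zero_iff.2 (γ.regular t ht)

end SphereCurve

/-- An embedded network in `𝕊²`: a family of curves (indexed by `ι`, finite in all that follows)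
with interior end point set `P` and boundary end point set `Q`. -/
structure Network (ι : Type*) where
  curve : ι → SphereCurve
  P : Set E3
  Q : Set E3
  disjoint : Disjoint P Q
  endpoints : P ∪ Q = {x | ∃ j b, (curve j).endpoint b = x}
  /-- different curves meet at most at their end points -/
  embedded : ∀ i j, i ≠ j → ∀ s t : unitInterval, (curve i).toFun s = (curve j).toFun t →
    (s = 0 ∨ s = 1) ∧ (t = 0 ∨ t = 1)
  /-- at a common end point the exterior tangents point in different directions -/
  tangents : ∀ i j a b, (i, a) ≠ (j, b) → (curve i).endpoint a = (curve j).endpoint b →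
    (curve i).outerTangent a ≠ (curve j).outerTangent b

/-- Functions on a network: a tuple of functions, one on each curve. -/
abbrev NetFun (ι : Type*) : Type _ := ι → unitInterval → ℝ

/-- `C^∞(𝒩)`: tuples of functions which are smooth up to the ends. -/
def smoothFun (ι : Type*) : Submodule ℝ (NetFun ι) where
  carrier := {u | ∀ j, ContDiffOn ℝ ∞ (ext01 (u j)) (Icc 0 1)}
  add_mem' := fun hu hv j => (hu j).add (hv j)
  zero_mem' := fun _ => contDiffOn_const
  smul_mem' := fun c _ hu j => (hu j).const_smul c

/-- `W^{1,2}(𝒩)`. Every class has exactly one continuous representative, and it is this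
representative that is used; it is absolutely continuous, its almost everywhere derivative is the
weak derivative, and its end values are the traces. -/
def sobolevFun (ι : Type*) : Set (NetFun ι) :=
  {u | ∀ j, AbsolutelyContinuousOnInterval (ext01 (u j)) 0 1 ∧
    MemLp (deriv (ext01 (u j))) 2 (volume.restrict (Icc 0 1))}

namespace Network

variable {ι : Type*} (N : Network ι)

/-- The ends of curves of the network which lie in `S`, a set of points: pairs of a curve and one
of its two ends. -/
abbrev EndsAt (S : Set E3) : Type _ := {h : ι × Bool // (N.curve h.1).endpoint h.2 ∈ S}

instance endsAtFintype [Finite ι] (S : Set E3) : Fintype (N.EndsAt S) := Fintype.ofFinite _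

/-- `V(S) = ⨁_{p ∈ S} ℝ^{j_p}` with the Euclidean inner product, where `j_p` is the number of
curves ending at `p`. -/
abbrev V (S : Set E3) : Type _ := EuclideanSpace ℝ (N.EndsAt S)

/-- `V₁(S)`: the elements of `V(S)` which, at each `p ∈ S`, are of the form `(X · ν^j)_j` for a
tangent vector `X` of the sphere at `p`. -/
def V1 (S : Set E3) : Submodule ℝ (N.V S) where
  carrier := {v | ∀ p ∈ S, ∃ X : E3, inner ℝ X p = 0 ∧
    ∀ h : N.EndsAt S, (N.curve h.1.1).endpoint h.1.2 = p →
      v h = inner ℝ X ((N.curve h.1.1).normal (endParam h.1.2))}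
  add_mem' := by
    intro v w hv hw p hp
    obtain ⟨X, hX, hX'⟩ := hv p hp
    obtain ⟨Y, hY, hY'⟩ := hw p hp
    refine ⟨X + Y, by rw [inner_add_left, hX, hY, add_zero], fun h hh => ?_⟩
    rw [inner_add_left, PiLp.add_apply, hX' h hh, hY' h hh]
  zero_mem' := fun p _ => ⟨0, by simp, fun h _ => by simp⟩
  smul_mem' := by
    intro c v hv p hp
    obtain ⟨X, hX, hX'⟩ := hv p hp
    refine ⟨c • X, by rw [real_inner_smul_left, hX, mul_zero], fun h hh => ?_⟩
    rw [real_inner_smul_left, PiLp.smul_apply, hX' h hh, smul_eq_mul]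

/-- `V₂(S)`: the orthogonal complement of `V₁(S)` in `V(S)`. -/
def V2 [Fintype ι] (S : Set E3) : Submodule ℝ (N.V S) := (N.V1 S)ᗮ

/-- Restriction of a function to the ends in `S`. -/
def trace (S : Set E3) : NetFun ι →ₗ[ℝ] N.V S where
  toFun u := WithLp.toLp 2 fun h => u h.1.1 (endParam h.1.2)
  map_add' _ _ := rfl
  map_smul' _ _ := rfl

/-- The exterior normal derivative `∂u/∂τ` (with respect to arc length) at the ends in `S`. -/
def normalDeriv (S : Set E3) : smoothFun ι →ₗ[ℝ] N.V S where
  toFun u := WithLp.toLp 2 fun h =>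
    endSign h.1.2 * (N.curve h.1.1).arcDeriv (ext01 (u.1 h.1.1)) (endParam h.1.2)
  map_add' u v := by
    ext h
    have hu := (u.2 h.1.1).differentiableOn (by simp) _ (endParam h.1.2).2
    have hv := (v.2 h.1.1).differentiableOn (by simp) _ (endParam h.1.2).2
    have := (N.curve h.1.1).arcDeriv_add hu hv
    simp only [PiLp.add_apply, ← mul_add, ← this]
    rfl
  map_smul' c u := by
    ext h
    have := (N.curve h.1.1).arcDeriv_smul (f := ext01 (u.1 h.1.1)) (t := endParam h.1.2) c
    simp only [PiLp.smul_apply, smul_eq_mul, RingHom.id_apply, mul_left_comm c, ← this]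
    rfl

/-- The operator `L u = Δ u + d u`, where `Δ` is the second derivative with respect to arc
length on each curve. -/
def opL (d : ι → ℝ → ℝ) : smoothFun ι →ₗ[ℝ] NetFun ι where
  toFun u := fun j t =>
    (N.curve j).arcDeriv ((N.curve j).arcDeriv (ext01 (u.1 j))) t + d j t * u.1 j t
  map_add' u v := by
    funext j t
    have du := (u.2 j).differentiableOn (by simp)
    have dv := (v.2 j).differentiableOn (by simp)
    have h1 : EqOn ((N.curve j).arcDeriv (ext01 ((u + v).1 j)))
        ((N.curve j).arcDeriv (ext01 (u.1 j)) + (N.curve j).arcDeriv (ext01 (v.1 j)))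
        (Icc 0 1) := fun s hs => (N.curve j).arcDeriv_add (du s hs) (dv s hs)
    have eu := ((N.curve j).arcDeriv_contDiffOn (u.2 j)).differentiableOn (by simp) t t.2
    have ev := ((N.curve j).arcDeriv_contDiffOn (v.2 j)).differentiableOn (by simp) t t.2
    have h2 := ((N.curve j).arcDeriv_congr h1 t.2).trans ((N.curve j).arcDeriv_add eu ev)
    have h3 : (u + v).1 j t = u.1 j t + v.1 j t := rfl
    simp only [Pi.add_apply, h2, h3]
    ring
  map_smul' c u := by
    funext j t
    have h1 : EqOn ((N.curve j).arcDeriv (ext01 ((c • u).1 j)))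
        (c • (N.curve j).arcDeriv (ext01 (u.1 j)))
        (Icc 0 1) := fun s _ => (N.curve j).arcDeriv_smul c
    have h2 := ((N.curve j).arcDeriv_congr h1 t.2).trans ((N.curve j).arcDeriv_smul c)
    have h3 : (c • u).1 j t = c * u.1 j t := rfl
    simp only [Pi.smul_apply, RingHom.id_apply, smul_eq_mul, h2, h3]
    ring

/-- `W^{1,2}_{0,1}(𝒩)`: Sobolev functions with values in `V₁(P)` on `P` and zero on `Q`. -/
def sobolev01 : Set (NetFun ι) :=
  {u | u ∈ sobolevFun ι ∧ N.trace N.P u ∈ N.V1 N.P ∧ N.trace N.Q u = 0}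

/-- The form `ℒ(u,v) = ∫_𝒩 ∇u · ∇v - d u v` (integrals and gradients with respect to arc
length). -/
def form [Fintype ι] (d : ι → ℝ → ℝ) (u v : NetFun ι) : ℝ :=
  ∑ j, ∫ t in (0 : ℝ)..1,
    ((deriv (ext01 (u j)) t / (N.curve j).speed t) * (deriv (ext01 (v j)) t / (N.curve j).speed t)
      - d j t * ext01 (u j) t * ext01 (v j) t) * (N.curve j).speed t

/-- The Morse index `Ind(𝒩)`: the maximal dimension of a subspace of `W^{1,2}_{0,1}(𝒩)` on which
`ℒ` is negative definite. -/
def index [Fintype ι] (d : ι → ℝ → ℝ) : ℕ∞ :=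
  ⨆ (W : Submodule ℝ (NetFun ι)) (_ : (W : Set (NetFun ι)) ⊆ N.sobolev01)
    (_ : ∀ u ∈ W, u ≠ 0 → N.form d u u < 0), Cardinal.toENat (Module.rank ℝ W)

/-- `𝒥₀⁰(𝒩)`: the smooth solutions of `L u = 0` with `u = 0` on `Q`, `u ∈ V₁(P)` and the
compatible condition `∂u/∂τ ∈ V₂(P)` on `P`. -/
def nullSpace [Fintype ι] (d : ι → ℝ → ℝ) : Submodule ℝ (smoothFun ι) :=
  LinearMap.ker (N.opL d) ⊓
  LinearMap.ker (N.trace N.Q ∘ₗ (smoothFun ι).subtype) ⊓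
  (N.V1 N.P).comap (N.trace N.P ∘ₗ (smoothFun ι).subtype) ⊓
  (N.V2 N.P).comap (N.normalDeriv N.P)

/-- `D_τ 𝒥₀⁰(S)`: the Neumann data on `S` of the null functions. -/
def neumannNull [Fintype ι] (d : ι → ℝ → ℝ) (S : Set E3) : Submodule ℝ (N.V S) :=
  (N.nullSpace d).map (N.normalDeriv S)

/-- `u` solves the extension problem for the Dirichlet datum `g` on `S ⊆ Q`: `L u = 0`, `u = g` on
`S`, `u = 0` on `Q \ S`, `u ∈ V₁(P)` and `∂u/∂τ ∈ V₂(P)` on `P`, and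
`∂u/∂τ ⊥ D_τ 𝒥₀⁰(S)` on `S`. -/
def IsExtension [Fintype ι] (d : ι → ℝ → ℝ) (S : Set E3) (g : N.V S) (u : smoothFun ι) : Prop :=
  N.opL d u = 0 ∧ N.trace S u.1 = g ∧ N.trace (N.Q \ S) u.1 = 0 ∧
  N.trace N.P u.1 ∈ N.V1 N.P ∧ N.normalDeriv N.P u ∈ N.V2 N.P ∧
  N.normalDeriv S u ∈ (N.neumannNull d S)ᗮ

/-- `T` is the Dirichlet-to-Neumann map on `S`: every `g ∈ (D_τ 𝒥₀⁰(S))ᗮ` has an extension `u` as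
above, and `T g = ∂u/∂τ` for every such `u`. -/
def IsDirichletToNeumann [Fintype ι] (d : ι → ℝ → ℝ) (S : Set E3)
    (T : (N.neumannNull d S)ᗮ →ₗ[ℝ] (N.neumannNull d S)ᗮ) : Prop :=
  ∀ g : (N.neumannNull d S)ᗮ, (∃ u, N.IsExtension d S (g : N.V S) u) ∧
    ∀ u, N.IsExtension d S (g : N.V S) u → N.normalDeriv S u = (T g : N.V S)

open Classical in
/-- The Dirichlet-to-Neumann map `T : (D_τ 𝒥₀⁰(S))ᗮ → (D_τ 𝒥₀⁰(S))ᗮ` (there is exactly one when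
`S ⊆ Q` and `d` is smooth). -/
def dirichletToNeumann [Fintype ι] (d : ι → ℝ → ℝ) (S : Set E3) :
    (N.neumannNull d S)ᗮ →ₗ[ℝ] (N.neumannNull d S)ᗮ :=
  if h : ∃ T, N.IsDirichletToNeumann d S T then h.choose else 0

/-- A partition of a network into `l` subnetworks along a subset `Pcut` of its interior end
points. The curve `j` belongs to the subnetwork `part j`. -/
structure Partition (l : ℕ) where
  part : ι → Fin l
  /-- the interior end points that are kept -/
  Pkeep : Set E3
  /-- the cut points -/
  Pcut : Set E3
  /-- the interior end points of the subnetworks -/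
  Psub : Fin l → Set E3
  /-- the boundary end points of the subnetworks at which the network was cut -/
  Qcut : Fin l → Set E3
  /-- the other boundary end points of the subnetworks -/
  Qkeep : Fin l → Set E3
  P_eq : Pkeep ∪ Pcut = N.P
  P_disjoint : Disjoint Pkeep Pcut
  Q_disjoint : ∀ i, Disjoint (Qcut i) (Qkeep i)
  sub_disjoint : ∀ i, Disjoint (Psub i) (Qcut i ∪ Qkeep i)
  sub_endpoints : ∀ i, Psub i ∪ (Qcut i ∪ Qkeep i) =
    {x | ∃ j b, part j = i ∧ (N.curve j).endpoint b = x}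
  Pkeep_eq : Pkeep = ⋃ i, Psub i
  Psub_disjoint : Pairwise fun i k => Disjoint (Psub i) (Psub k)
  Pcut_eq : Pcut = ⋃ i, Qcut i
  Q_eq : N.Q = ⋃ i, Qkeep i

namespace Partition

variable {N} {l : ℕ} (p : N.Partition l)

/-- The `i`-th subnetwork. -/
def sub (i : Fin l) : Network {j // p.part j = i} where
  curve j := N.curve j.1
  P := p.Psub i
  Q := p.Qcut i ∪ p.Qkeep i
  disjoint := p.sub_disjoint i
  endpoints := by
    rw [p.sub_endpoints i]
    ext x
    constructor
    · rintro ⟨j, b, hj, hx⟩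
      exact ⟨⟨j, hj⟩, b, hx⟩
    · rintro ⟨j, b, hx⟩
      exact ⟨j.1, b, j.2, hx⟩
  embedded i j hij s t h := N.embedded i.1 j.1 (fun e => hij (Subtype.ext e)) s t h
  tangents i j a b hij h := N.tangents i.1 j.1 a b
    (fun e => hij (by rw [Prod.mk.injEq] at e ⊢; exact ⟨Subtype.ext e.1, e.2⟩)) h

/-- The restriction of the potential `d` to the `i`-th subnetwork. -/
def subPotential (d : ι → ℝ → ℝ) (i : Fin l) : {j // p.part j = i} → ℝ → ℝ := fun j => d j.1

theorem Qcut_subset (i : Fin l) : p.Qcut i ⊆ p.Pcut := by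
  rw [p.Pcut_eq]
  exact subset_iUnion p.Qcut i

theorem mem_Qcut {j : ι} {b : Bool} (h : (N.curve j).endpoint b ∈ p.Pcut) :
    (N.curve j).endpoint b ∈ p.Qcut (p.part j) := by
  have h1 : (N.curve j).endpoint b ∈ p.Psub (p.part j) ∪
      (p.Qcut (p.part j) ∪ p.Qkeep (p.part j)) := by
    rw [p.sub_endpoints]
    exact ⟨j, b, rfl, rfl⟩
  rcases h1 with h1 | h1 | h1
  · have : (N.curve j).endpoint b ∈ p.Pkeep := by
      rw [p.Pkeep_eq]
      exact mem_iUnion_of_mem _ h1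
    exact absurd h (disjoint_left.1 p.P_disjoint this)
  · exact h1
  · have hQ : (N.curve j).endpoint b ∈ N.Q := by
      rw [p.Q_eq]
      exact mem_iUnion_of_mem _ h1
    have hP : (N.curve j).endpoint b ∈ N.P := by
      rw [← p.P_eq]
      exact Or.inr h
    exact absurd hQ (disjoint_left.1 N.disjoint hP)

/-- The restriction `V(Pcut) → V(Qcut i)` of the identification
`V(Pcut) ≅ ⨁ i, V(Qcut i)`. -/
def res (i : Fin l) : N.V p.Pcut →ₗ[ℝ] (p.sub i).V (p.Qcut i) where
  toFun g := WithLp.toLp 2 fun h => g ⟨(h.1.1.1, h.1.2), p.Qcut_subset i h.2⟩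
  map_add' _ _ := rfl
  map_smul' _ _ := rfl

/-- The inverse `⨁ i, V(Qcut i) → V(Pcut)` of the identification
`V(Pcut) ≅ ⨁ i, V(Qcut i)`. -/
def glue : ((i : Fin l) → (p.sub i).V (p.Qcut i)) →ₗ[ℝ] N.V p.Pcut where
  toFun f := WithLp.toLp 2 fun h =>
    f (p.part h.1.1) ⟨(⟨h.1.1, rfl⟩, h.1.2), p.mem_Qcut h.2⟩
  map_add' _ _ := rfl
  map_smul' _ _ := rfl

variable [Fintype ι] (d : ι → ℝ → ℝ)

/-- `D_τ 𝒥₀⁰(Qcut i)` for the `i`-th subnetwork. -/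
def subNeumannNull (i : Fin l) : Submodule ℝ ((p.sub i).V (p.Qcut i)) :=
  (p.sub i).neumannNull (p.subPotential d i) (p.Qcut i)

/-- `⨁ i, D_τ 𝒥₀⁰(Qcut i)` as a subspace of `V(Pcut)`. -/
def sumNeumannNull : Submodule ℝ (N.V p.Pcut) :=
  ⨅ i, (p.subNeumannNull d i).comap (p.res i)

/-- `⨁ i, (D_τ 𝒥₀⁰(Qcut i))ᗮ` as a subspace of `V(Pcut)`. -/
def sumNeumannNullPerp : Submodule ℝ (N.V p.Pcut) :=
  ⨅ i, ((p.subNeumannNull d i)ᗮ).comap (p.res i)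

/-- The Dirichlet-to-Neumann map of the `i`-th subnetwork. -/
def subDN (i : Fin l) : (p.subNeumannNull d i)ᗮ →ₗ[ℝ] (p.subNeumannNull d i)ᗮ :=
  (p.sub i).dirichletToNeumann (p.subPotential d i) (p.Qcut i)

/-- `T̂`: the sum of the Dirichlet-to-Neumann maps of the subnetworks. -/
def hatT : p.sumNeumannNullPerp d →ₗ[ℝ] N.V p.Pcut :=
  p.glue ∘ₗ LinearMap.pi fun i =>
    (p.subNeumannNull d i)ᗮ.subtype ∘ₗ p.subDN d i ∘ₗ
      (p.res i).restrict (p := p.sumNeumannNullPerp d) (q := (p.subNeumannNull d i)ᗮ)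
        (fun _ hg => (Submodule.mem_iInf _).1 hg i)

/-- `V̄₁`: the intersection of `⨁ i, (D_τ 𝒥₀⁰(Qcut i))ᗮ` and `V₁(Pcut)`. -/
def barV1 : Submodule ℝ (N.V p.Pcut) := p.sumNeumannNullPerp d ⊓ N.V1 p.Pcut

/-- `T̄ : V̄₁ → V̄₁`: the map `T̂` followed by the orthogonal projection onto `V̄₁`. -/
def barT : p.barV1 d →ₗ[ℝ] p.barV1 d :=
  (p.barV1 d).orthogonalProjectionOnto.toLinearMap ∘ₗ p.hatT d ∘ₗ
    Submodule.inclusion (inf_le_left : p.barV1 d ≤ p.sumNeumannNullPerp d)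

/-- `Ind(T̄)`: the dimension of the sum of the eigenspaces of `T̄` with negative eigenvalues. -/
def indexBarT : ℕ :=
  Module.finrank ℝ (⨆ (σ : ℝ) (_ : σ < 0), Module.End.eigenspace (p.barT d) σ :
    Submodule ℝ (p.barV1 d))

/-- `F₂`: the Neumann data of null functions of the subnetworks that lie in `V₂(Pcut)`. -/
def F2 : Submodule ℝ (N.V p.Pcut) := p.sumNeumannNull d ⊓ N.V2 p.Pcut

/-- `F₁`: the orthogonal complement of `F₂` in the Neumann data of null functions of the
subnetworks. -/
def F1 : Submodule ℝ (N.V p.Pcut) := p.sumNeumannNull d ⊓ (p.F2 d)ᗮ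

end Partition

end Network

end

/-!
Let `H = W^{1,2}_{0,1}(N)`, and let `tr : H → V₁(Pcut)` be the trace at the cut points, which is
onto. The index of `ℒ` on `H` is assembled from three pieces.

* The kernel `K` of `tr` is the direct sum of the spaces `W^{1,2}_{0,1}` of the subnetworks, and
  `ℒ` is the sum of their forms; so the index of `ℒ` on `K` is the sum of their indices.
* A *broken solution* is an element of `H` which solves `L u = 0` on each curve and satisfies the
  compatibility condition at the end points that are not cut. By Green's formula
  (`form_brokenSolutions`) `ℒ(z, h) = ⟨∂z/∂τ, tr h⟩` for a broken solution `z` and `h ∈ H`, so the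
  broken solutions are `ℒ`-orthogonal to `K`. The Fredholm alternative on the subnetworks gives, for
  every `g ∈ V̄₁`, a broken solution with trace `g`, and on these `ℒ` is the quadratic form of `T̄`.
* The broken solutions with zero trace are the null vectors of `ℒ` on `K`. They pair with `h ∈ H`
  as `⟨x, tr h⟩`, where `x ∈ D` is their Neumann datum, and the pairing vanishes exactly for `x` in
  `F₂`. A space isomorphic to `F₁` therefore consists of isotropic vectors paired nondegenerately
  with a complement, and such a hyperbolic space has index `dim F₁`.

The linear algebra is `hasMorseIndex_of_trace`. The index is handled through `HasMorseIndex`: a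
finite-dimensional negative definite space together with nonnegativity on its orthogonal complement.
This is what makes the argument free of regularity theory and of spectral theory for `L`: nothing
is minimized. Finiteness of the index is `exists_curveForm_nonneg`: by a Poincaré inequality the
form is nonnegative on functions vanishing at sufficiently many equidistant points, which is a
finite number of linear conditions.

The Fredholm alternative `exists_solution_trace_eq` is a dimension count. Solutions of `L u = 0` on
the curves form a space of twice as many dimensions as there are curves, because the initial value
problem is uniquely solvable (`exists_solution_system`, `eq_zero_of_solution`), and this is also the
number of boundary conditions, one for each end. The symmetry of Green's formula puts the range of
the boundary operator into the annihilator of the Neumann data of its kernel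
(`exists_of_symm_of_annihilates`), and the two have the same dimension.
-/

open Set MeasureTheory
open scoped ContDiff
noncomputable section

/-! ### Negative index of a symmetric bilinear form -/

section MorseIndex

variable {H : Type*} [AddCommGroup H] [Module ℝ H]

/-- The symmetric form `B` has negative index `n`: there is an `n`-dimensional negative definite
subspace, presented by a linear map `φ`, on whose `B`-orthogonal complement `B` is nonnegative. -/
def HasMorseIndex (B : LinearMap.BilinForm ℝ H) (n : ℕ) : Prop :=
  ∃ φ : (Fin n → ℝ) →ₗ[ℝ] H, (∀ f, f ≠ 0 → B (φ f) (φ f) < 0) ∧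
    ∀ w, (∀ f, B w (φ f) = 0) → 0 ≤ B w w

theorem HasMorseIndex.rank_le {B : LinearMap.BilinForm ℝ H} {n : ℕ} (h : HasMorseIndex B n)
    (W : Submodule ℝ H) (hW : ∀ w ∈ W, w ≠ 0 → B w w < 0) : Module.rank ℝ W ≤ n := by
  obtain ⟨φ, -, h2⟩ := h
  let ψ : W →ₗ[ℝ] Module.Dual ℝ (Fin n → ℝ) :=
    { toFun := fun w => (B w).comp φ
      map_add' := fun a b => by ext; simp
      map_smul' := fun a b => by ext; simp }
  have hψ : Function.Injective ψ := by
    rw [injective_iff_map_eq_zero]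
    intro w hw
    by_contra hne
    have h3 := hW w w.2 (by simpa using hne)
    have h4 := h2 w (fun f => by simpa [ψ] using LinearMap.congr_fun hw f)
    linarith
  have := LinearMap.lift_rank_le_of_injective ψ hψ
  rw [← Module.finrank_eq_rank ℝ (Module.Dual ℝ (Fin n → ℝ)), Subspace.dual_finrank_eq] at this
  simpa using this

theorem HasMorseIndex.exists_submodule {B : LinearMap.BilinForm ℝ H} {n : ℕ}
    (h : HasMorseIndex B n) :
    ∃ W : Submodule ℝ H, (∀ w ∈ W, w ≠ 0 → B w w < 0) ∧ Module.rank ℝ W = n := by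
  obtain ⟨φ, h1, -⟩ := h
  refine ⟨LinearMap.range φ, ?_, ?_⟩
  · rintro _ ⟨f, rfl⟩ hf
    exact h1 f (fun h0 => hf (by simp [h0]))
  · have hφ : Function.Injective φ := by
      rw [injective_iff_map_eq_zero]
      intro f hf
      by_contra hne
      simpa [hf] using h1 f hne
    rw [← Module.finrank_eq_rank, LinearMap.finrank_range_of_inj hφ, Module.finrank_fin_fun]

/-- A negative definite space injects into the target of any linear map on whose kernel the form is
nonnegative. -/
theorem finrank_le_of_neg {B : LinearMap.BilinForm ℝ H} {F G : Type*} [AddCommGroup F] [Module ℝ F]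
    [AddCommGroup G] [Module ℝ G] [FiniteDimensional ℝ G]
    (φ : F →ₗ[ℝ] H) (hφ : ∀ f, f ≠ 0 → B (φ f) (φ f) < 0)
    (ψ : H →ₗ[ℝ] G) (hψ : ∀ w, ψ w = 0 → 0 ≤ B w w) :
    Module.finrank ℝ F ≤ Module.finrank ℝ G := by
  refine LinearMap.finrank_le_finrank_of_injective (f := ψ ∘ₗ φ) ?_
  rw [injective_iff_map_eq_zero]
  intro f hf
  by_contra hne
  have h1 := hφ f hne
  have h2 := hψ _ hf
  linarith

theorem neg_coprod {B : LinearMap.BilinForm ℝ H} (hB : ∀ x y, B x y = B y x) {F F' : Type*}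
    [AddCommGroup F] [Module ℝ F] [AddCommGroup F'] [Module ℝ F'] {φ : F →ₗ[ℝ] H} {φ' : F' →ₗ[ℝ] H}
    (hφ : ∀ f, f ≠ 0 → B (φ f) (φ f) < 0) (hφ' : ∀ f, f ≠ 0 → B (φ' f) (φ' f) < 0)
    (horth : ∀ f f', B (φ' f') (φ f) = 0) (x : F × F') (hx : x ≠ 0) :
    B (φ.coprod φ' x) (φ.coprod φ' x) < 0 := by
  have h1 : B (φ x.1) (φ' x.2) = 0 := by rw [hB, horth]
  have key : B (φ.coprod φ' x) (φ.coprod φ' x) = B (φ x.1) (φ x.1) + B (φ' x.2) (φ' x.2) := by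
    simp [LinearMap.coprod_apply, h1, horth]
  rw [key]
  by_cases h2 : x.1 = 0
  · have h3 : x.2 ≠ 0 := fun h3 => hx (Prod.ext h2 h3)
    simpa [h2] using hφ' _ h3
  · have h4 := hφ _ h2
    by_cases h3 : x.2 = 0
    · simpa [h3] using h4
    · have := hφ' _ h3
      linarith

theorem neg_coprod_toSpanSingleton {B : LinearMap.BilinForm ℝ H} (hB : ∀ x y, B x y = B y x)
    {F : Type*} [AddCommGroup F] [Module ℝ F] {φ : F →ₗ[ℝ] H} (hφ : ∀ f, f ≠ 0 → B (φ f) (φ f) < 0)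
    {w : H} (hw : ∀ f, B w (φ f) = 0) (hneg : B w w < 0) (x : F × ℝ) (hx : x ≠ 0) :
    B (φ.coprod (LinearMap.toSpanSingleton ℝ H w) x)
      (φ.coprod (LinearMap.toSpanSingleton ℝ H w) x) < 0 := by
  refine neg_coprod hB hφ ?_ ?_ x hx
  · intro c hc
    have : 0 < c * c := mul_self_pos.2 hc
    simp only [LinearMap.toSpanSingleton_apply, map_smul, LinearMap.smul_apply, smul_eq_mul]
    nlinarith
  · intro f c
    simp [hw]

/-- A negative definite space of dimension at least that of the target of a linear map with
nonnegative kernel computes the index. -/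
theorem HasMorseIndex.of_neg_of_ker {B : LinearMap.BilinForm ℝ H} (hB : ∀ x y, B x y = B y x)
    {F G : Type*} [AddCommGroup F] [Module ℝ F] [FiniteDimensional ℝ F]
    [AddCommGroup G] [Module ℝ G] [FiniteDimensional ℝ G]
    (φ : F →ₗ[ℝ] H) (hφ : ∀ f, f ≠ 0 → B (φ f) (φ f) < 0)
    (ψ : H →ₗ[ℝ] G) (hψ : ∀ w, ψ w = 0 → 0 ≤ B w w)
    (hGF : Module.finrank ℝ G ≤ Module.finrank ℝ F) :
    HasMorseIndex B (Module.finrank ℝ F) := by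
  let e : (Fin (Module.finrank ℝ F) → ℝ) ≃ₗ[ℝ] F := (Module.finBasis ℝ F).equivFun.symm
  refine ⟨φ ∘ₗ e.toLinearMap, fun f hf => hφ _ (by simpa using hf), fun w hw => ?_⟩
  by_contra hneg
  have hw' : ∀ f, B w (φ f) = 0 := fun f => by simpa using hw (e.symm f)
  have := finrank_le_of_neg _ (neg_coprod_toSpanSingleton hB hφ hw' (not_le.1 hneg)) ψ hψ
  rw [Module.finrank_prod, Module.finrank_self] at this
  omega

/-- The index exists as soon as the form is nonnegative on a subspace of finite codimension: a
negative definite space of maximal dimension has nonnegative complement. -/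
theorem exists_hasMorseIndex {B : LinearMap.BilinForm ℝ H} (hB : ∀ x y, B x y = B y x) {G : Type*}
    [AddCommGroup G] [Module ℝ G] [FiniteDimensional ℝ G]
    (ψ : H →ₗ[ℝ] G) (hψ : ∀ w, ψ w = 0 → 0 ≤ B w w) : ∃ n, HasMorseIndex B n := by
  let P : ℕ → Prop := fun n => ∃ φ : (Fin n → ℝ) →ₗ[ℝ] H, ∀ f, f ≠ 0 → B (φ f) (φ f) < 0
  have hbd : ∀ n, P n → n ≤ Module.finrank ℝ G := by
    rintro n ⟨φ, hφ⟩
    simpa using finrank_le_of_neg φ hφ ψ hψ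
  classical
  have h0 : P 0 := ⟨0, fun f hf => absurd (Subsingleton.elim f 0) hf⟩
  set n := Nat.findGreatest P (Module.finrank ℝ G) with hn
  obtain ⟨φ, hφ⟩ : P n := Nat.findGreatest_spec (P := P) (Nat.zero_le (Module.finrank ℝ G)) h0
  refine ⟨n, φ, hφ, fun w hw => ?_⟩
  by_contra hneg
  have hext := neg_coprod_toSpanSingleton hB hφ hw (not_le.1 hneg)
  have hfr : Module.finrank ℝ (Fin (n + 1) → ℝ) = Module.finrank ℝ ((Fin n → ℝ) × ℝ) := by
    simp
  let e := LinearEquiv.ofFinrankEq _ _ hfr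
  have h1 : P (n + 1) := ⟨(φ.coprod (LinearMap.toSpanSingleton ℝ H w)) ∘ₗ e.toLinearMap,
    fun f hf => hext (e f) (by simpa using hf)⟩
  have := Nat.le_findGreatest (hbd _ h1) h1
  omega

/-- The form being nondegenerate on a finite-dimensional negative definite space, there is a
`B`-orthogonal projection onto that space. -/
theorem exists_projection_of_neg {B : LinearMap.BilinForm ℝ H} {F : Type*}
    [AddCommGroup F] [Module ℝ F] [FiniteDimensional ℝ F]
    (φ : F →ₗ[ℝ] H) (hφ : ∀ f, f ≠ 0 → B (φ f) (φ f) < 0) :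
    ∃ π : H →ₗ[ℝ] F, ∀ h f, B (h - φ (π h)) (φ f) = 0 := by
  let g : F →ₗ[ℝ] Module.Dual ℝ F := B.compl₁₂ φ φ
  have hg : Function.Injective g := by
    rw [injective_iff_map_eq_zero]
    intro f hf
    by_contra hne
    have h1 := hφ f hne
    have h2 : B (φ f) (φ f) = 0 := LinearMap.congr_fun hf f
    linarith
  let e := LinearEquiv.ofInjectiveOfFinrankEq g hg Subspace.dual_finrank_eq.symm
  refine ⟨e.symm.toLinearMap ∘ₗ (B.compl₁₂ LinearMap.id φ), fun h f => ?_⟩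
  have h3 : g (e.symm (B.compl₁₂ LinearMap.id φ h)) = B.compl₁₂ LinearMap.id φ h :=
    e.apply_symm_apply _
  have h4 := LinearMap.congr_fun h3 f
  simp only [g, LinearMap.compl₁₂_apply, LinearMap.id_apply] at h4
  simp [h4]

/-- A linear section over a subspace of the range. -/
theorem exists_linear_section {M G : Type*} [AddCommGroup M] [Module ℝ M] [AddCommGroup G]
    [Module ℝ G] (f : M →ₗ[ℝ] G) (S : Submodule ℝ G) (hS : ∀ g ∈ S, ∃ m, f m = g) :
    ∃ s : S →ₗ[ℝ] M, ∀ g, f (s g) = g := by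
  obtain ⟨r, hr⟩ := f.rangeRestrict.exists_rightInverse_of_surjective (f.range_rangeRestrict)
  refine ⟨r ∘ₗ Submodule.inclusion (fun g hg => hS g hg), fun g => ?_⟩
  exact congrArg Subtype.val (LinearMap.congr_fun hr _)

/-! ### Negative eigenspaces of a symmetric operator -/

section Spectral

variable {V : Type*} [NormedAddCommGroup V] [InnerProductSpace ℝ V] [FiniteDimensional ℝ V]

/-- The sum of the eigenspaces with negative eigenvalues. -/
def negEigenspace (T : V →ₗ[ℝ] V) : Submodule ℝ V :=
  ⨆ (σ : ℝ) (_ : σ < 0), Module.End.eigenspace T σ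

theorem inner_self_eq_sum_eigenvalues {T : V →ₗ[ℝ] V} (hT : T.IsSymmetric) (x : V) :
    inner ℝ (T x) x =
      ∑ i, hT.eigenvalues rfl i * inner ℝ (hT.eigenvectorBasis rfl i) x ^ 2 := by
  rw [← (hT.eigenvectorBasis rfl).sum_inner_mul_inner]
  refine Finset.sum_congr rfl fun i _ => ?_
  rw [hT, hT.apply_eigenvectorBasis, real_inner_smul_right, real_inner_comm]
  simp only [RCLike.ofReal_real_eq_id, id_eq]
  ring

theorem eigenvectorBasis_mem_negEigenspace {T : V →ₗ[ℝ] V} (hT : T.IsSymmetric)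
    (i : Fin (Module.finrank ℝ V)) (hi : hT.eigenvalues rfl i < 0) :
    hT.eigenvectorBasis rfl i ∈ negEigenspace T := by
  refine Submodule.mem_iSup_of_mem _ (Submodule.mem_iSup_of_mem hi ?_)
  rw [Module.End.mem_eigenspace_iff]
  exact hT.apply_eigenvectorBasis rfl i

theorem inner_eigenvectorBasis_of_mem_negEigenspace {T : V →ₗ[ℝ] V} (hT : T.IsSymmetric)
    (i : Fin (Module.finrank ℝ V)) (hi : 0 ≤ hT.eigenvalues rfl i) {x : V}
    (hx : x ∈ negEigenspace T) : inner ℝ (hT.eigenvectorBasis rfl i) x = 0 := by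
  have hle : negEigenspace T ≤ (ℝ ∙ (hT.eigenvectorBasis rfl i : V))ᗮ := by
    refine iSup₂_le fun σ hσ y hy => ?_
    rw [Submodule.mem_orthogonal_singleton_iff_inner_right]
    rw [Module.End.mem_eigenspace_iff] at hy
    have h1 := hT (hT.eigenvectorBasis rfl i) y
    rw [hT.apply_eigenvectorBasis, hy, inner_smul_right, inner_smul_left] at h1
    simp only [RCLike.ofReal_real_eq_id, id_eq, conj_trivial] at h1
    have h2 : (hT.eigenvalues rfl i - σ) * inner ℝ (hT.eigenvectorBasis rfl i) y = 0 := by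
      linarith
    rcases mul_eq_zero.1 h2 with h | h
    · linarith
    · exact h
  exact Submodule.mem_orthogonal_singleton_iff_inner_right.1 (hle hx)

theorem inner_neg_of_mem_negEigenspace {T : V →ₗ[ℝ] V} (hT : T.IsSymmetric) {x : V}
    (hx : x ∈ negEigenspace T) (hne : x ≠ 0) : inner ℝ (T x) x < 0 := by
  rw [inner_self_eq_sum_eigenvalues hT]
  have hle : ∀ i, hT.eigenvalues rfl i * inner ℝ (hT.eigenvectorBasis rfl i) x ^ 2 ≤ 0 := by
    intro i
    rcases lt_or_ge (hT.eigenvalues rfl i) 0 with h | h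
    · exact mul_nonpos_of_nonpos_of_nonneg h.le (sq_nonneg _)
    · simp [inner_eigenvectorBasis_of_mem_negEigenspace hT i h hx]
  refine lt_of_le_of_ne (Finset.sum_nonpos fun i _ => hle i) fun h0 => hne ?_
  rw [Finset.sum_eq_zero_iff_of_nonpos fun i _ => hle i] at h0
  refine InnerProductSpace.ext_inner_left_basis (𝕜 := ℝ)
    (hT.eigenvectorBasis rfl).toBasis fun i => ?_
  rw [inner_zero_right, OrthonormalBasis.coe_toBasis]
  rcases lt_or_ge (hT.eigenvalues rfl i) 0 with h | h
  · have := h0 i (Finset.mem_univ i)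
    simpa [h.ne] using this
  · exact inner_eigenvectorBasis_of_mem_negEigenspace hT i h hx

theorem inner_nonneg_of_orthogonal_negEigenspace {T : V →ₗ[ℝ] V} (hT : T.IsSymmetric) {x : V}
    (hx : ∀ e ∈ negEigenspace T, inner ℝ (T e) x = 0) : 0 ≤ inner ℝ (T x) x := by
  rw [inner_self_eq_sum_eigenvalues hT]
  refine Finset.sum_nonneg fun i _ => ?_
  rcases lt_or_ge (hT.eigenvalues rfl i) 0 with h | h
  · have := hx _ (eigenvectorBasis_mem_negEigenspace hT i h)
    rw [hT.apply_eigenvectorBasis, inner_smul_left] at this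
    have h2 : inner ℝ (hT.eigenvectorBasis rfl i) x = 0 := by simpa [h.ne] using this
    simp [h2]
  · exact mul_nonneg h (sq_nonneg _)

end Spectral

/-! ### The index of a form relative to a trace map -/

/-- Abstract index theorem. `tr` is a trace map onto `U`, the vectors in `Z` satisfy Green's formula
with conormal derivative `nd`, and `D` is the space of conormal derivatives of the elements of `Z`
without trace. The index of `B` is the sum of its index on `ker tr` (computed by `φA`), of the index
of the operator `T` representing `B` on the traces of `Z`, and of the number of dimensions in which
the null vectors of `ker tr` pair nontrivially with the traces: together with vectors dual to them,
these span a hyperbolic space. -/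
theorem hasMorseIndex_of_trace {G A : Type*} [NormedAddCommGroup G] [InnerProductSpace ℝ G]
    [FiniteDimensional ℝ G] [AddCommGroup A] [Module ℝ A] [FiniteDimensional ℝ A]
    {B : LinearMap.BilinForm ℝ H} (hB : ∀ x y, B x y = B y x) (tr : H →ₗ[ℝ] G) (U : Submodule ℝ G)
    (htr : ∀ h, tr h ∈ U) (hsurj : ∀ g ∈ U, ∃ h, tr h = g)
    {Z : Type*} [AddCommGroup Z] [Module ℝ Z] (j : Z →ₗ[ℝ] H) (nd : Z →ₗ[ℝ] G)
    (hgreen : ∀ z h, B (j z) h = inner ℝ (nd z) (tr h))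
    (D : Submodule ℝ G) (hD : ∀ x, x ∈ D ↔ ∃ z, tr (j z) = 0 ∧ nd z = x)
    (U' : Submodule ℝ G) (hU' : ∀ x, x ∈ U' ↔ x ∈ Dᗮ ∧ x ∈ U)
    (T : U' →ₗ[ℝ] U') (hT : ∀ g : U', ∃ z, tr (j z) = g ∧
      ∀ g' : U', inner ℝ (nd z) (g' : G) = inner ℝ (T g) g')
    (φA : A →ₗ[ℝ] H) (hAtr : ∀ a, tr (φA a) = 0) (hAneg : ∀ a, a ≠ 0 → B (φA a) (φA a) < 0)
    (hAmax : ∀ k, tr k = 0 → (∀ a, B k (φA a) = 0) → 0 ≤ B k k) :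
    HasMorseIndex B (Module.finrank ℝ A + Module.finrank ℝ (negEigenspace T) +
      Module.finrank ℝ (D ⊓ (D ⊓ Uᗮ)ᗮ : Submodule ℝ G)) := by
  obtain ⟨s, hs⟩ := exists_linear_section (tr ∘ₗ j) U'
    (fun g hg => by obtain ⟨z, hz, -⟩ := hT ⟨g, hg⟩; exact ⟨z, hz⟩)
  replace hs : ∀ g, tr (j (s g)) = g := hs
  have hDU' : ∀ x ∈ D, ∀ g : U', inner ℝ x (g : G) = 0 := fun x hx g =>
    ((Submodule.mem_orthogonal _ _).1 ((hU' _).1 g.2).1) x hx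
  -- two elements of `Z` with equal trace have the same conormal derivative modulo `D`
  have hsT : ∀ g g' : U', inner ℝ (nd (s g)) (g' : G) = inner ℝ (T g) g' := by
    intro g g'
    obtain ⟨z, hz, hz'⟩ := hT g
    rw [← hz', ← sub_eq_zero, ← inner_sub_left, ← map_sub]
    refine hDU' _ ((hD _).2 ⟨s g - z, ?_, rfl⟩) _
    simp [hs, hz]
  have hTsymm : T.IsSymmetric := by
    intro g g'
    have h1 := hgreen (s g) (j (s g'))
    have h2 := hgreen (s g') (j (s g))
    rw [hs, hsT] at h1 h2
    rw [← h1, hB, h2, real_inner_comm]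
  set F1 : Submodule ℝ G := D ⊓ (D ⊓ Uᗮ)ᗮ with hF1
  -- `j (c f)` is the null vector of `ker tr` with conormal derivative `f`
  obtain ⟨c₀, hc₀⟩ := exists_linear_section
    (nd ∘ₗ (LinearMap.ker (tr ∘ₗ j)).subtype) F1 (fun g hg => by
      obtain ⟨z, hz, hz'⟩ := (hD g).1 hg.1
      exact ⟨⟨z, hz⟩, hz'⟩)
  let c : F1 →ₗ[ℝ] Z := (LinearMap.ker (tr ∘ₗ j)).subtype ∘ₗ c₀
  have hctr : ∀ f, tr (j (c f)) = 0 := fun f => (c₀ f).2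
  have hcnd : ∀ f, nd (c f) = f := hc₀
  obtain ⟨x₀, hx₀⟩ := exists_linear_section tr U hsurj
  let P : F1 →ₗ[ℝ] U := U.orthogonalProjectionOnto.toLinearMap ∘ₗ F1.subtype
  let φN : A × negEigenspace T →ₗ[ℝ] H :=
    φA.coprod (j ∘ₗ s ∘ₗ (negEigenspace T).subtype)
  have hNtr : ∀ n, tr (φN n) = ((n.2 : U') : G) := by
    intro n
    simp [φN, LinearMap.coprod_apply, hAtr, hs]
  have hNneg : ∀ n, n ≠ 0 → B (φN n) (φN n) < 0 := by
    refine neg_coprod hB hAneg ?_ ?_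
    · intro e he
      have h1 := hgreen (s e) (j (s e))
      rw [hs, hsT] at h1
      have := inner_neg_of_mem_negEigenspace hTsymm e.2 (by simpa using he)
      simpa [h1] using this
    · intro a e
      have := hgreen (s e) (φA a)
      rw [hAtr, inner_zero_right] at this
      exact this
  obtain ⟨π, hπ⟩ := exists_projection_of_neg φN hNneg
  -- `x f` has trace `P f` up to an element of `U'` and is orthogonal to the range of `φN`
  let x : F1 →ₗ[ℝ] H := (LinearMap.id - φN ∘ₗ π) ∘ₗ x₀ ∘ₗ P
  have hxN : ∀ f n, B (x f) (φN n) = 0 := fun f n => by simpa [x] using hπ (x₀ (P f)) n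
  have hcx : ∀ f f', B (j (c f)) (x f') = inner ℝ (f : G) (P f' : G) := by
    intro f f'
    rw [hgreen, hcnd]
    simp only [x, LinearMap.comp_apply, LinearMap.sub_apply, LinearMap.id_apply, map_sub, hNtr,
      hx₀, inner_sub_right]
    rw [hDU' f f.2.1, sub_zero]
  have hcc : ∀ f f', B (j (c f)) (j (c f')) = 0 := by
    intro f f'
    rw [hgreen, hctr, inner_zero_right]
  have hcN : ∀ f n, B (j (c f)) (φN n) = 0 := by
    intro f n
    rw [hgreen, hcnd, hNtr, hDU' f f.2.1]
  have hpos : ∀ f, f ≠ 0 → 0 < B (j (c f)) (x f) := by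
    intro f hf
    rw [hcx]
    have h1 : inner ℝ (f : G) (P f : G) = inner ℝ (P f : G) (P f : G) := by
      have : inner ℝ ((f : G) - P f) (P f : G) = 0 :=
        Submodule.starProjection_inner_eq_zero (K := U) (f : G) _ (P f).2
      rw [inner_sub_left] at this
      linarith
    rw [h1]
    refine lt_of_le_of_ne real_inner_self_nonneg fun h0 => hf ?_
    have h2 : P f = 0 := by
      have := inner_self_eq_zero.1 h0.symm
      exact_mod_cast this
    have h3 : (f : G) ∈ Uᗮ := by
      rw [← Submodule.orthogonalProjectionOnto_eq_zero_iff]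
      exact h2
    have h4 := (Submodule.mem_orthogonal _ _).1 f.2.2 f ⟨f.2.1, h3⟩
    exact_mod_cast inner_self_eq_zero.1 h4
  let β : F1 →ₗ[ℝ] Module.Dual ℝ F1 := B.compl₁₂ (j ∘ₗ c) x
  have hβ : Function.Injective β := by
    rw [injective_iff_map_eq_zero]
    intro f hf
    by_contra hne
    have h1 := hpos f hne
    have h2 : B (j (c f)) (x f) = 0 := LinearMap.congr_fun hf f
    linarith
  let eβ := LinearEquiv.ofInjectiveOfFinrankEq β hβ Subspace.dual_finrank_eq.symm
  -- `M` is chosen so that `x - c ∘ M` is negative definite with form `-B (j (c f)) (x f)`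
  let M : F1 →ₗ[ℝ] F1 := eβ.symm.toLinearMap ∘ₗ ((1 / 2 : ℝ) • (B.compl₁₂ x x + β))
  have hM : ∀ f, B (j (c (M f))) (x f) = 1 / 2 * (B (x f) (x f) + B (j (c f)) (x f)) := by
    intro f
    have h3 : β (M f) = ((1 / 2 : ℝ) • (B.compl₁₂ x x + β)) f := eβ.apply_symm_apply _
    have h4 := LinearMap.congr_fun h3 f
    simp only [β, LinearMap.smul_apply, LinearMap.add_apply, LinearMap.compl₁₂_apply,
      LinearMap.comp_apply, smul_eq_mul] at h4
    exact h4
  let y : F1 →ₗ[ℝ] H := x - j ∘ₗ c ∘ₗ M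
  have hyneg : ∀ f, f ≠ 0 → B (y f) (y f) < 0 := by
    intro f hf
    have h1 := hpos f hf
    have h2 : B (x f) (j (c (M f))) = B (j (c (M f))) (x f) := hB _ _
    have h3 := hM f
    have : B (y f) (y f) = -B (j (c f)) (x f) := by
      simp only [y, LinearMap.sub_apply, LinearMap.comp_apply, map_sub,
        h2, hcc]
      linarith
    rw [this]
    linarith
  have hyN : ∀ n f, B (y f) (φN n) = 0 := by
    intro n f
    simp [y, hxN, hcN]
  -- a vector orthogonal to the range of `φN` and to the isotropic vectors `j (c f)` has trace in
  -- `U'`, and splits into an element of `ker tr` and one of the range of `j ∘ₗ s`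
  let ψ : H →ₗ[ℝ] Module.Dual ℝ (A × negEigenspace T) × Module.Dual ℝ F1 :=
    LinearMap.prod (B.compl₁₂ LinearMap.id φN) (B.compl₁₂ LinearMap.id (j ∘ₗ c))
  have key := HasMorseIndex.of_neg_of_ker hB (φN.coprod y) (neg_coprod hB hNneg hyneg hyN) ψ
    (fun w hw => ?_) (by simp [Module.finrank_prod, Subspace.dual_finrank_eq])
  · rwa [Module.finrank_prod, Module.finrank_prod] at key
  · have hw1 : ∀ n, B w (φN n) = 0 := fun n => LinearMap.congr_fun (congrArg Prod.fst hw) n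
    have hw2 : ∀ f, B w (j (c f)) = 0 := fun n => LinearMap.congr_fun (congrArg Prod.snd hw) n
    have hwU : tr w ∈ U' := by
      refine (hU' _).2 ⟨(Submodule.mem_orthogonal _ _).2 fun d hd => ?_, htr w⟩
      set f₂ := (D ⊓ Uᗮ).starProjection d with hf₂
      have hf₂m : f₂ ∈ D ⊓ Uᗮ := Submodule.starProjection_apply_mem _ _
      have hf₁m : d - f₂ ∈ F1 :=
        ⟨D.sub_mem hd hf₂m.1, Submodule.sub_starProjection_mem_orthogonal _⟩
      have h1 := hgreen (c ⟨_, hf₁m⟩) w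
      rw [hcnd, hB, hw2, inner_sub_left, (Submodule.mem_orthogonal' _ _).1 hf₂m.2 _ (htr w)]
        at h1
      linarith
    set g : U' := ⟨tr w, hwU⟩ with hg
    have hk : tr (w - j (s g)) = 0 := by rw [map_sub, hs, hg, sub_self]
    have h1 : B (j (s g)) (w - j (s g)) = 0 := by rw [hgreen, hk, inner_zero_right]
    have h2 : B (w - j (s g)) (j (s g)) = 0 := by rw [hB, h1]
    have h3 : B (j (s g)) (j (s g)) = inner ℝ (T g) g := by rw [hgreen, hs, hsT]
    have h4 : B w w = B (w - j (s g)) (w - j (s g)) + B (j (s g)) (j (s g)) := by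
      have : B w w = B ((w - j (s g)) + j (s g)) ((w - j (s g)) + j (s g)) := by rw [sub_add_cancel]
      rw [this, map_add, map_add, LinearMap.add_apply, LinearMap.add_apply, h1, h2]
      ring
    rw [h4, h3]
    refine add_nonneg (hAmax _ hk fun a => ?_)
      (inner_nonneg_of_orthogonal_negEigenspace hTsymm fun e he => ?_)
    · have h5 := hw1 (a, 0)
      have h6 : B (j (s g)) (φA a) = 0 := by rw [hgreen, hAtr, inner_zero_right]
      simpa [φN, h6] using h5
    · have h5 := hw1 (0, ⟨e, he⟩)
      have h6 : B w (j (s e)) = 0 := by simpa [φN] using h5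
      rw [hB, hgreen] at h6
      have h7 := hsT e g
      rw [← h7]
      exact h6

end MorseIndex

/-! ### Linear systems of two equations on the unit interval -/

section ODE

/-- Truncation of the coordinates of a vector at height `R`. -/
def clamp (R : ℝ) (x : ℝ × ℝ) : ℝ × ℝ := (max (-R) (min R x.1), max (-R) (min R x.2))

theorem lipschitzWith_clamp (R : ℝ) : LipschitzWith 1 (clamp R) := by
  have h := (LipschitzWith.prod_fst (α := ℝ) (β := ℝ)).const_min R |>.const_max (-R)
  have h' := (LipschitzWith.prod_snd (α := ℝ) (β := ℝ)).const_min R |>.const_max (-R)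
  have h2 := h.prodMk h'
  rw [max_self] at h2
  exact h2

theorem clamp_eq_self {R : ℝ} {x : ℝ × ℝ} (h : ‖x‖ ≤ R) : clamp R x = x := by
  rw [Prod.norm_def, max_le_iff, Real.norm_eq_abs, Real.norm_eq_abs, abs_le, abs_le] at h
  simp [clamp, h.1.1, h.1.2, h.2.1, h.2.2]

theorem norm_clamp_le {R : ℝ} (hR : 0 ≤ R) (x : ℝ × ℝ) : ‖clamp R x‖ ≤ R := by
  rw [Prod.norm_def, max_le_iff, Real.norm_eq_abs, Real.norm_eq_abs, abs_le, abs_le]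
  refine ⟨⟨le_max_left _ _, max_le (by linarith) (min_le_left _ _)⟩,
    ⟨le_max_left _ _, max_le (by linarith) (min_le_left _ _)⟩⟩

theorem norm_clamp_le_norm {R : ℝ} (hR : 0 ≤ R) (x : ℝ × ℝ) : ‖clamp R x‖ ≤ ‖x‖ := by
  have h := (lipschitzWith_clamp R).dist_le_mul x 0
  have h0 : clamp R 0 = 0 := clamp_eq_self (by simpa using hR)
  simpa [h0] using h

theorem norm_system_le {M a b : ℝ} (ha : |a| ≤ M) (hb : |b| ≤ M) (x : ℝ × ℝ) :
    ‖(a * x.2, b * x.1)‖ ≤ M * ‖x‖ := by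
  have hM : 0 ≤ M := (abs_nonneg a).trans ha
  rw [Prod.norm_mk, max_le_iff, norm_mul, norm_mul, Real.norm_eq_abs a, Real.norm_eq_abs b]
  exact ⟨mul_le_mul ha (norm_snd_le x) (norm_nonneg _) hM,
    mul_le_mul hb (norm_fst_le x) (norm_nonneg _) hM⟩

/-- Global solvability of a linear system. The Picard–Lindelöf theorem applies to the system
truncated at a height which, by Grönwall's inequality, its solution does not reach. -/
theorem exists_solution_system {a b : ℝ → ℝ} (ha : ContinuousOn a (Icc 0 1))
    (hb : ContinuousOn b (Icc 0 1)) (x₀ : ℝ × ℝ) :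
    ∃ α : ℝ → ℝ × ℝ, α 0 = x₀ ∧ ∀ t ∈ Icc (0 : ℝ) 1,
      HasDerivWithinAt α (a t * (α t).2, b t * (α t).1) (Icc 0 1) t := by
  obtain ⟨Ma, hMa⟩ := isCompact_Icc.exists_bound_of_continuousOn ha
  obtain ⟨Mb, hMb⟩ := isCompact_Icc.exists_bound_of_continuousOn hb
  set M := max Ma Mb with hM
  have hMa' : ∀ t ∈ Icc (0 : ℝ) 1, |a t| ≤ M := fun t ht => (hMa t ht).trans (le_max_left _ _)
  have hMb' : ∀ t ∈ Icc (0 : ℝ) 1, |b t| ≤ M := fun t ht => (hMb t ht).trans (le_max_right _ _)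
  have hM0 : 0 ≤ M := (abs_nonneg _).trans (hMa' 0 (by simp))
  set R := ‖x₀‖ * Real.exp M with hR
  have hR0 : 0 ≤ R := by positivity
  have hPL : IsPicardLindelof (fun t x => (a t * (clamp R x).2, b t * (clamp R x).1))
      (⟨0, by simp⟩ : Icc (0 : ℝ) 1) x₀ ⟨M * R, by positivity⟩ 0 ⟨M * R, by positivity⟩
      ⟨M, hM0⟩ := by
    constructor
    · intro t ht
      refine (LipschitzWith.of_dist_le_mul fun x y => ?_).lipschitzOnWith
      have h1 := norm_system_le (hMa' t ht) (hMb' t ht) (clamp R x - clamp R y)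
      have h2 := (lipschitzWith_clamp R).dist_le_mul x y
      rw [dist_eq_norm, NNReal.coe_one, one_mul] at h2
      rw [dist_eq_norm]
      refine le_trans (le_of_eq ?_) (h1.trans (mul_le_mul_of_nonneg_left h2 hM0))
      congr 1
      ext <;> simp <;> ring
    · intro x _
      exact (ha.mul continuousOn_const).prodMk (hb.mul continuousOn_const)
    · intro t ht x _
      exact (norm_system_le (hMa' t ht) (hMb' t ht) _).trans
        (mul_le_mul_of_nonneg_left (norm_clamp_le hR0 x) hM0)
    · simp
  obtain ⟨α, h0, hα⟩ := hPL.exists_eq_forall_mem_Icc_hasDerivWithinAt₀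
  have h0' : α 0 = x₀ := h0
  refine ⟨α, h0', fun t ht => ?_⟩
  have hbound := norm_le_gronwallBound_of_norm_deriv_right_le (f := α) (δ := ‖x₀‖) (K := M) (ε := 0)
    (a := 0) (b := 1) (HasDerivWithinAt.continuousOn hα)
    (fun s hs => (hα s ⟨hs.1, hs.2.le⟩).mono_of_mem_nhdsWithin (by
      exact Icc_mem_nhdsGE_of_mem hs))
    (by rw [h0']) (fun s hs => by
      have hs' : s ∈ Icc (0 : ℝ) 1 := ⟨hs.1, hs.2.le⟩
      rw [add_zero]
      exact (norm_system_le (hMa' s hs') (hMb' s hs') _).trans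
        (mul_le_mul_of_nonneg_left (norm_clamp_le_norm hR0 _) hM0)) t ht
  rw [gronwallBound_ε0, sub_zero] at hbound
  have hle : ‖α t‖ ≤ R := hbound.trans (mul_le_mul_of_nonneg_left
    (Real.exp_le_exp.2 (mul_le_of_le_one_right hM0 ht.2)) (norm_nonneg _))
  simpa only [clamp_eq_self hle] using hα t ht

end ODE

namespace SphereCurve

variable (γ : SphereCurve)

theorem contDiffOn_speed : ContDiffOn ℝ ∞ γ.speed (Icc 0 1) :=
  (γ.smooth.derivWithin uniqueDiffOn_Icc_zero_one (by simp)).norm ℝ γ.regular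

theorem speed_pos {t : ℝ} (ht : t ∈ Icc (0 : ℝ) 1) : 0 < γ.speed t :=
  norm_pos_iff.2 (γ.regular t ht)

theorem hasDerivWithinAt_of_contDiffOn {f : ℝ → ℝ} (hf : ContDiffOn ℝ ∞ f (Icc 0 1)) {t : ℝ}
    (ht : t ∈ Icc (0 : ℝ) 1) :
    HasDerivWithinAt f (γ.speed t * γ.arcDeriv f t) (Icc 0 1) t := by
  have h := (hf.differentiableOn (by simp) t ht).hasDerivWithinAt
  rwa [arcDeriv, mul_div_cancel₀ _ (γ.speed_pos ht).ne']

theorem arcDeriv_eq_of_hasDerivWithinAt {f : ℝ → ℝ} {f' t : ℝ} (ht : t ∈ Icc (0 : ℝ) 1)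
    (hf : HasDerivWithinAt f f' (Icc 0 1) t) : γ.arcDeriv f t = f' / γ.speed t := by
  rw [arcDeriv, hf.derivWithin (uniqueDiffOn_Icc_zero_one t ht)]

/-- The initial value problem for `u'' + d u = 0` (derivatives in arc length) is solvable. -/
theorem exists_solution {d : ℝ → ℝ} (hd : ContDiffOn ℝ ∞ d (Icc 0 1)) (x y : ℝ) :
    ∃ u : ℝ → ℝ, ContDiffOn ℝ ∞ u (Icc 0 1) ∧ u 0 = x ∧ γ.arcDeriv u 0 = y ∧
      ∀ t ∈ Icc (0 : ℝ) 1, γ.arcDeriv (γ.arcDeriv u) t + d t * u t = 0 := by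
  have hs := γ.contDiffOn_speed
  have hb : ContDiffOn ℝ ∞ (fun t => -(γ.speed t * d t)) (Icc 0 1) := (hs.mul hd).neg
  obtain ⟨α, h0, hα⟩ := exists_solution_system hs.continuousOn hb.continuousOn (x, y)
  have hF : ContDiffOn ℝ ∞ (Function.uncurry fun (t : ℝ) (x : ℝ × ℝ) =>
      (γ.speed t * x.2, -(γ.speed t * d t) * x.1)) (Icc (0 : ℝ) 1 ×ˢ univ) := by
    have hfst : MapsTo (Prod.fst : ℝ × ℝ × ℝ → ℝ) (Icc (0 : ℝ) 1 ×ˢ univ) (Icc 0 1) :=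
      fun x hx => hx.1
    refine ContDiffOn.prodMk ?_ ?_
    · exact (hs.comp contDiffOn_fst hfst).mul (contDiff_snd.comp contDiff_snd).contDiffOn
    · exact (hb.comp contDiffOn_fst hfst).mul (contDiff_fst.comp contDiff_snd).contDiffOn
  have hsm := ODE.contDiffOn_enat_Icc_of_hasDerivWithinAt (n := ⊤) hF hα (fun _ _ => mem_univ _)
  have hu : ∀ t ∈ Icc (0 : ℝ) 1, γ.arcDeriv (fun t => (α t).1) t = (α t).2 := fun t ht => by
    have h1 : HasDerivWithinAt (fun t => (α t).1) (γ.speed t * (α t).2) (Icc 0 1) t := by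
      simpa using (hα t ht).hasFDerivWithinAt.fst.hasDerivWithinAt
    rw [γ.arcDeriv_eq_of_hasDerivWithinAt ht h1,
      mul_div_cancel_left₀ _ (γ.speed_pos ht).ne']
  refine ⟨fun t => (α t).1, contDiff_fst.comp_contDiffOn hsm, congrArg Prod.fst h0,
    by rw [hu 0 (by simp), h0], fun t ht => ?_⟩
  have h2 : HasDerivWithinAt (fun t => (α t).2) (-(γ.speed t * d t) * (α t).1) (Icc 0 1) t := by
    simpa using (hα t ht).hasFDerivWithinAt.snd.hasDerivWithinAt
  rw [γ.arcDeriv_congr hu ht, γ.arcDeriv_eq_of_hasDerivWithinAt ht h2]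
  have := (γ.speed_pos ht).ne'
  field_simp
  ring

theorem eq_zero_of_solution {d : ℝ → ℝ} (hd : ContDiffOn ℝ ∞ d (Icc 0 1)) {u : ℝ → ℝ}
    (hu : ContDiffOn ℝ ∞ u (Icc 0 1))
    (hL : ∀ t ∈ Icc (0 : ℝ) 1, γ.arcDeriv (γ.arcDeriv u) t + d t * u t = 0)
    (h0 : u 0 = 0) (h0' : γ.arcDeriv u 0 = 0) : ∀ t ∈ Icc (0 : ℝ) 1, u t = 0 := by
  have hs := γ.contDiffOn_speed
  have hb : ContDiffOn ℝ ∞ (fun t => -(γ.speed t * d t)) (Icc 0 1) := (hs.mul hd).neg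
  obtain ⟨Ma, hMa⟩ := isCompact_Icc.exists_bound_of_continuousOn hs.continuousOn
  obtain ⟨Mb, hMb⟩ := isCompact_Icc.exists_bound_of_continuousOn hb.continuousOn
  have hp := γ.arcDeriv_contDiffOn hu
  have hder : ∀ t ∈ Ico (0 : ℝ) 1, HasDerivWithinAt (fun t => (u t, γ.arcDeriv u t))
      (γ.speed t * γ.arcDeriv u t, -(γ.speed t * d t) * u t) (Ici t) t := fun t ht => by
    have ht' : t ∈ Icc (0 : ℝ) 1 := ⟨ht.1, ht.2.le⟩
    have h1 := γ.hasDerivWithinAt_of_contDiffOn hu ht'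
    have h2 := γ.hasDerivWithinAt_of_contDiffOn hp ht'
    have h3 : γ.speed t * γ.arcDeriv (γ.arcDeriv u) t = -(γ.speed t * d t) * u t := by
      rw [eq_neg_of_add_eq_zero_left (hL t ht')]
      ring
    rw [h3] at h2
    exact (h1.prodMk h2).mono_of_mem_nhdsWithin (Icc_mem_nhdsGE_of_mem ht)
  have hbound : ∀ t ∈ Ico (0 : ℝ) 1, ‖(γ.speed t * γ.arcDeriv u t, -(γ.speed t * d t) * u t)‖ ≤
      max Ma Mb * ‖(u t, γ.arcDeriv u t)‖ := fun t ht => by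
    have ht' : t ∈ Icc (0 : ℝ) 1 := ⟨ht.1, ht.2.le⟩
    exact norm_system_le ((hMa t ht').trans (le_max_left _ _))
      ((hMb t ht').trans (le_max_right _ _)) (u t, γ.arcDeriv u t)
  have key := eq_zero_of_abs_deriv_le_mul_abs_self_of_eq_zero_right
    (hu.continuousOn.prodMk hp.continuousOn) hder (by rw [h0, h0']; rfl) hbound
  exact fun t ht => congrArg Prod.fst (key t ht)

end SphereCurve

/-! ### The quadratic form on one curve -/

theorem ext01_apply (u : unitInterval → ℝ) (t : unitInterval) : ext01 u t = u t :=
  IccExtend_val _ _ _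

/-- `W^{1,2}(0,1)`, by continuous representatives. -/
def sobolevInterval : Submodule ℝ (unitInterval → ℝ) where
  carrier := {f | AbsolutelyContinuousOnInterval (ext01 f) 0 1 ∧
    MemLp (deriv (ext01 f)) 2 (volume.restrict (Icc 0 1))}
  add_mem' := by
    rintro f g ⟨hf, hf'⟩ ⟨hg, hg'⟩
    refine ⟨hf.add hg, (hf'.add hg').ae_eq ?_⟩
    rw [Filter.EventuallyEq, ae_restrict_iff' measurableSet_Icc]
    filter_upwards [hf.ae_differentiableAt, hg.ae_differentiableAt] with t h1 h2 ht
    rw [uIcc_of_le zero_le_one] at h1 h2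
    exact (deriv_add (h1 ht) (h2 ht)).symm
  zero_mem' := by
    have h : ext01 (0 : unitInterval → ℝ) = fun _ => 0 := rfl
    refine ⟨?_, ?_⟩
    · rw [h]
      exact (contDiffOn_const (n := 1)).absolutelyContinuousOnInterval
    · rw [h, deriv_const']
      exact MemLp.zero
  smul_mem' := by
    rintro c f ⟨hf, hf'⟩
    refine ⟨hf.const_smul c, (hf'.const_smul c).ae_eq ?_⟩
    rw [Filter.EventuallyEq, ae_restrict_iff' measurableSet_Icc]
    filter_upwards [hf.ae_differentiableAt] with t h1 ht
    rw [uIcc_of_le zero_le_one] at h1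
    exact (deriv_const_smul c (h1 ht)).symm

theorem mem_sobolevInterval_of_contDiffOn {f : unitInterval → ℝ}
    (hf : ContDiffOn ℝ ∞ (ext01 f) (Icc 0 1)) : f ∈ sobolevInterval := by
  refine ⟨?_, ?_⟩
  · refine ContDiffOn.absolutelyContinuousOnInterval ?_
    rw [uIcc_of_le zero_le_one]
    exact hf.of_le (by simp)
  · have hc : ContinuousOn (derivWithin (ext01 f) (Icc 0 1)) (Icc 0 1) :=
      hf.continuousOn_derivWithin uniqueDiffOn_Icc_zero_one (by simp)
    obtain ⟨C, hC⟩ := isCompact_Icc.exists_bound_of_continuousOn hc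
    have hm : MemLp (derivWithin (ext01 f) (Icc 0 1)) 2 (volume.restrict (Icc (0 : ℝ) 1)) := by
      refine MemLp.of_bound (hc.aestronglyMeasurable measurableSet_Icc) C ?_
      rw [ae_restrict_iff' measurableSet_Icc]
      exact Filter.Eventually.of_forall hC
    refine hm.ae_eq ?_
    rw [← Measure.restrict_congr_set Ioo_ae_eq_Icc, Filter.EventuallyEq,
      ae_restrict_iff' measurableSet_Ioo]
    exact Filter.Eventually.of_forall fun t ht => derivWithin_of_mem_nhds (Icc_mem_nhds ht.1 ht.2)

namespace SphereCurve

variable (γ : SphereCurve)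

/-- The integrand of the form `∫ ∇f · ∇g - d f g`, in the parameter of the curve. -/
def formIntegrand (d : ℝ → ℝ) (f g : unitInterval → ℝ) (t : ℝ) : ℝ :=
  ((deriv (ext01 f) t / γ.speed t) * (deriv (ext01 g) t / γ.speed t)
      - d t * ext01 f t * ext01 g t) * γ.speed t

/-- The form `∫ ∇f · ∇g - d f g` on one curve; it is the summand in `Network.form`. -/
def curveForm (d : ℝ → ℝ) (f g : unitInterval → ℝ) : ℝ :=
  ∫ t in (0 : ℝ)..1, γ.formIntegrand d f g t

variable {γ} {d : ℝ → ℝ} {f g h : unitInterval → ℝ}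

theorem intervalIntegrable_deriv_mul_deriv (hf : f ∈ sobolevInterval)
    (hg : g ∈ sobolevInterval) :
    IntervalIntegrable (fun t => deriv (ext01 f) t * deriv (ext01 g) t) volume 0 1 := by
  rw [intervalIntegrable_iff_integrableOn_Icc_of_le zero_le_one]
  exact hf.2.integrable_mul hg.2

theorem intervalIntegrable_formIntegrand (hd : ContDiffOn ℝ ∞ d (Icc 0 1))
    (hf : f ∈ sobolevInterval) (hg : g ∈ sobolevInterval) :
    IntervalIntegrable (γ.formIntegrand d f g) volume 0 1 := by
  have hI : uIcc (0 : ℝ) 1 = Icc 0 1 := uIcc_of_le zero_le_one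
  have hs : ContinuousOn γ.speed (uIcc 0 1) := hI ▸ γ.contDiffOn_speed.continuousOn
  have hs0 : ∀ t ∈ uIcc (0 : ℝ) 1, γ.speed t ≠ 0 := fun t ht => (γ.speed_pos (hI ▸ ht)).ne'
  have hd' : ContinuousOn d (uIcc 0 1) := hI ▸ hd.continuousOn
  have h1 := (intervalIntegrable_deriv_mul_deriv hf hg).continuousOn_mul (hs.inv₀ hs0)
  have h2 : ContinuousOn (fun t => d t * ext01 f t * ext01 g t * γ.speed t) (uIcc 0 1) :=
    ((hd'.mul hf.1.continuousOn).mul hg.1.continuousOn).mul hs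
  refine (h1.sub h2.intervalIntegrable).congr_uIoo ?_
  intro t ht
  have := hs0 t (uIoo_subset_uIcc_self ht)
  simp only [formIntegrand, Pi.inv_apply]
  field_simp

theorem curveForm_comm (f g : unitInterval → ℝ) : γ.curveForm d f g = γ.curveForm d g f := by
  refine intervalIntegral.integral_congr fun t _ => ?_
  simp only [formIntegrand]
  ring

theorem curveForm_add_left (hd : ContDiffOn ℝ ∞ d (Icc 0 1)) (hf : f ∈ sobolevInterval)
    (hg : g ∈ sobolevInterval) (hh : h ∈ sobolevInterval) :
    γ.curveForm d (f + g) h = γ.curveForm d f h + γ.curveForm d g h := by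
  rw [curveForm, curveForm, curveForm, ← intervalIntegral.integral_add
    (intervalIntegrable_formIntegrand hd hf hh) (intervalIntegrable_formIntegrand hd hg hh)]
  refine intervalIntegral.integral_congr_ae ?_
  filter_upwards [hf.1.ae_differentiableAt, hg.1.ae_differentiableAt] with t h1 h2 ht
  have ht' := uIoc_subset_uIcc ht
  have h3 : deriv (ext01 (f + g)) t = deriv (ext01 f) t + deriv (ext01 g) t :=
    deriv_add (h1 ht') (h2 ht')
  have h4 : ext01 (f + g) t = ext01 f t + ext01 g t := rfl
  simp only [formIntegrand, h3, h4]
  ring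

theorem curveForm_smul_left (c : ℝ) (hf : f ∈ sobolevInterval) :
    γ.curveForm d (c • f) g = c * γ.curveForm d f g := by
  rw [curveForm, curveForm, ← intervalIntegral.integral_const_mul]
  refine intervalIntegral.integral_congr_ae ?_
  filter_upwards [hf.1.ae_differentiableAt] with t h1 ht
  have h3 : deriv (ext01 (c • f)) t = c * deriv (ext01 f) t :=
    deriv_const_smul c (h1 (uIoc_subset_uIcc ht))
  have h4 : ext01 (c • f) t = c * ext01 f t := rfl
  simp only [formIntegrand, h3, h4]
  ring

/-- Green's formula on one curve. -/
theorem curveForm_eq_boundary {z : unitInterval → ℝ} (hz : ContDiffOn ℝ ∞ (ext01 z) (Icc 0 1))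
    (hL : ∀ t ∈ Icc (0 : ℝ) 1, γ.arcDeriv (γ.arcDeriv (ext01 z)) t + d t * ext01 z t = 0)
    (hg : g ∈ sobolevInterval) :
    γ.curveForm d z g =
      γ.arcDeriv (ext01 z) 1 * ext01 g 1 - γ.arcDeriv (ext01 z) 0 * ext01 g 0 := by
  have hp := γ.arcDeriv_contDiffOn hz
  have hpac : AbsolutelyContinuousOnInterval (γ.arcDeriv (ext01 z)) 0 1 := by
    refine ContDiffOn.absolutelyContinuousOnInterval ?_
    rw [uIcc_of_le zero_le_one]
    exact hp.of_le (by simp)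
  rw [← hpac.integral_deriv_mul_eq_sub hg.1]
  refine intervalIntegral.integral_congr_uIoo fun t ht => ?_
  rw [uIoo_of_le zero_le_one] at ht
  have ht' : t ∈ Icc (0 : ℝ) 1 := Ioo_subset_Icc_self ht
  have hn : Icc (0 : ℝ) 1 ∈ nhds t := Icc_mem_nhds ht.1 ht.2
  have hs := (γ.speed_pos ht').ne'
  have h1 := ((γ.hasDerivWithinAt_of_contDiffOn hz ht').hasDerivAt hn).deriv
  have h2 := ((γ.hasDerivWithinAt_of_contDiffOn hp ht').hasDerivAt hn).deriv
  have h3 := hL t ht'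
  rw [eq_neg_of_add_eq_zero_left h3] at h2
  simp only [formIntegrand, h1, h2]
  field_simp
  ring

/-! ### Functions with many zeros -/

/-- If `u` vanishes at the left end of a cell, its values on the cell are controlled by its
derivative. -/
theorem sq_le_mul_integral_deriv_sq {u : ℝ → ℝ} {a b : ℝ} (hab : a ≤ b)
    (hu : AbsolutelyContinuousOnInterval u a b)
    (hu' : IntervalIntegrable (fun t => deriv u t ^ 2) volume a b) (h0 : u a = 0) {t : ℝ}
    (ht : t ∈ Icc a b) : u t ^ 2 ≤ (b - a) * ∫ x in a..b, deriv u x ^ 2 := by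
  have hsub : uIcc a t ⊆ uIcc a b := uIcc_subset_uIcc_left (by rwa [uIcc_of_le hab])
  have hut := hu.mono hsub
  have hut' := hu'.mono_set hsub
  have hle : ∫ x in a..t, deriv u x ^ 2 ≤ ∫ x in a..b, deriv u x ^ 2 :=
    intervalIntegral.integral_mono_interval le_rfl ht.1 ht.2
      (Filter.Eventually.of_forall fun x => sq_nonneg _) hu'
  have hI0 : 0 ≤ ∫ x in a..t, deriv u x ^ 2 :=
    intervalIntegral.integral_nonneg ht.1 fun x _ => sq_nonneg _
  rcases eq_or_lt_of_le ht.1 with rfl | hlt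
  · rw [h0]
    have := mul_nonneg (sub_nonneg.2 hab) (hI0.trans hle)
    simpa using this
  -- the integral of `(u' - c)²` is nonnegative for the mean value `c` of `u'`
  set c := u t / (t - a) with hc
  have hpos : 0 < t - a := sub_pos.2 hlt
  have h1 : 0 ≤ ∫ x in a..t, (deriv u x ^ 2 - 2 * c * deriv u x + c ^ 2) := by
    refine intervalIntegral.integral_nonneg ht.1 fun x _ => ?_
    nlinarith [sq_nonneg (deriv u x - c)]
  have hd := hut.intervalIntegrable_deriv
  rw [intervalIntegral.integral_add (hut'.sub (hd.const_mul _)) intervalIntegrable_const,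
    intervalIntegral.integral_sub hut' (hd.const_mul _), intervalIntegral.integral_const_mul,
    hut.integral_deriv_eq_sub, h0, intervalIntegral.integral_const, smul_eq_mul, sub_zero] at h1
  have h2 : u t = c * (t - a) := by rw [hc, div_mul_cancel₀ _ hpos.ne']
  have h3 : u t ^ 2 ≤ (t - a) * ∫ x in a..t, deriv u x ^ 2 := by
    have h4 : c ^ 2 * (t - a) ≤ ∫ x in a..t, deriv u x ^ 2 := by
      rw [h2] at h1
      nlinarith
    calc u t ^ 2 = (t - a) * (c ^ 2 * (t - a)) := by rw [h2]; ring
      _ ≤ _ := mul_le_mul_of_nonneg_left h4 hpos.le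
  refine h3.trans (mul_le_mul (by linarith [ht.2]) hle hI0 (by linarith))

/-- On the functions which vanish at sufficiently many equidistant points the form is
nonnegative. -/
theorem exists_curveForm_nonneg (γ : SphereCurve) (hd : ContDiffOn ℝ ∞ d (Icc 0 1)) :
    ∃ (m : ℕ) (ψ : (unitInterval → ℝ) →ₗ[ℝ] (Fin m → ℝ)), ∀ f ∈ sobolevInterval, ψ f = 0 →
      0 ≤ γ.curveForm d f f := by
  obtain ⟨S, hS⟩ := isCompact_Icc.exists_bound_of_continuousOn γ.contDiffOn_speed.continuousOn
  obtain ⟨C, hC⟩ := isCompact_Icc.exists_bound_of_continuousOn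
    (hd.mul γ.contDiffOn_speed).continuousOn
  have hSpos : 0 < S := (γ.speed_pos (t := 0) (by simp)).trans_le
    ((le_abs_self _).trans (hS 0 (by simp)))
  have hC0 : 0 ≤ C := (abs_nonneg _).trans (hC 0 (by simp))
  obtain ⟨m, hm⟩ := exists_nat_gt (max 1 (C * S))
  have hm1 : (1 : ℝ) < m := (le_max_left _ _).trans_lt hm
  have hm0 : (0 : ℝ) < m := by linarith
  have hmCS : C * S ≤ m := ((le_max_right _ _).trans_lt hm).le
  have hmem : ∀ k : ℕ, k ≤ m → (k : ℝ) / m ∈ Icc (0 : ℝ) 1 := fun k hk =>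
    ⟨by positivity, (div_le_one hm0).2 (by exact_mod_cast hk)⟩
  refine ⟨m, LinearMap.pi fun k => LinearMap.proj (⟨(k : ℝ) / m, hmem k k.2.le⟩ : unitInterval),
    fun f hf hψ => ?_⟩
  have hI := intervalIntegrable_formIntegrand (γ := γ) hd hf hf
  have hdd := intervalIntegrable_deriv_mul_deriv hf hf
  simp only [← pow_two] at hdd
  have hsub : ∀ k < m, uIcc ((k : ℝ) / m) ((k + 1 : ℕ) / m) ⊆ uIcc 0 1 := fun k hk => by
    rw [uIcc_of_le zero_le_one]
    exact uIcc_subset_Icc (hmem k hk.le) (hmem (k + 1) hk)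
  have hsum := intervalIntegral.sum_integral_adjacent_intervals (n := m)
    (f := γ.formIntegrand d f f) (μ := volume) (a := fun k : ℕ => (k : ℝ) / m)
    (fun k hk => hI.mono_set (hsub k hk))
  simp only [Nat.cast_zero, zero_div, div_self hm0.ne'] at hsum
  rw [curveForm, ← hsum]
  refine Finset.sum_nonneg fun k hk => ?_
  rw [Finset.mem_range] at hk
  have hlen : ((k + 1 : ℕ) : ℝ) / m - k / m = 1 / m := by
    push_cast
    ring
  have hle : (k : ℝ) / m ≤ (k + 1 : ℕ) / m := by
    rw [← sub_nonneg, hlen]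
    positivity
  have hk0 : ext01 f ((k : ℝ) / m) = 0 := by
    have h1 : f ⟨(k : ℝ) / m, hmem k hk.le⟩ = 0 := congrFun hψ ⟨k, hk⟩
    rw [← h1]
    exact ext01_apply f ⟨(k : ℝ) / m, hmem k hk.le⟩
  set a := (k : ℝ) / m
  set b := ((k + 1 : ℕ) : ℝ) / m
  have hac := hf.1.mono (hsub k hk)
  have hdd' := hdd.mono_set (hsub k hk)
  set J := ∫ x in a..b, deriv (ext01 f) x ^ 2 with hJ
  have hJ0 : 0 ≤ J := intervalIntegral.integral_nonneg hle fun x _ => sq_nonneg _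
  -- the integrand is bounded below by `f'² / S - C J / m`
  have hlow : ∫ x in a..b, (S⁻¹ * deriv (ext01 f) x ^ 2 - C * (1 / m * J)) ≤
      ∫ x in a..b, γ.formIntegrand d f f x := by
    refine intervalIntegral.integral_mono_on hle
      ((hdd'.const_mul _).sub intervalIntegrable_const) (hI.mono_set (hsub k hk)) fun x hx => ?_
    have hx' : x ∈ Icc (0 : ℝ) 1 := by
      have := hsub k hk (by rw [uIcc_of_le hle]; exact hx)
      rwa [uIcc_of_le zero_le_one] at this
    have h1 := sq_le_mul_integral_deriv_sq hle hac hdd' hk0 hx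
    rw [hlen, ← hJ] at h1
    have hs := γ.speed_pos hx'
    have h2 : S⁻¹ * deriv (ext01 f) x ^ 2 ≤ (γ.speed x)⁻¹ * deriv (ext01 f) x ^ 2 :=
      mul_le_mul_of_nonneg_right (inv_anti₀ hs ((le_abs_self _).trans (hS x hx'))) (sq_nonneg _)
    have h3 : d x * γ.speed x * ext01 f x ^ 2 ≤ C * (1 / m * J) :=
      mul_le_mul ((le_abs_self _).trans (hC x hx')) h1 (sq_nonneg _) hC0
    have h4 : γ.formIntegrand d f f x =
        (γ.speed x)⁻¹ * deriv (ext01 f) x ^ 2 - d x * γ.speed x * ext01 f x ^ 2 := by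
      simp only [formIntegrand]
      field_simp
    rw [h4]
    linarith
  refine le_trans ?_ hlow
  rw [intervalIntegral.integral_sub (hdd'.const_mul _) intervalIntegrable_const,
    intervalIntegral.integral_const_mul, intervalIntegral.integral_const, hlen, smul_eq_mul, ← hJ]
  have h5 : 1 / (m : ℝ) * (C * (1 / m * J)) ≤ S⁻¹ * J := by
    have h6 : 1 / (m : ℝ) * (C * (1 / m * J)) = (C / m ^ 2) * J := by
      field_simp
    rw [h6]
    refine mul_le_mul_of_nonneg_right ?_ hJ0
    rw [div_le_iff₀ (by positivity), inv_mul_eq_div, le_div_iff₀ hSpos]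
    nlinarith
  linarith

end SphereCurve

/-! ### The Fredholm alternative -/

/-- Fredholm alternative in finite dimensions: the boundary operator `Θ` and the complementary
boundary operator `Θ'` are related by a symmetric Green's formula, so the range of `Θ` is contained
in the annihilator of `Θ' (ker Θ)`, and the two have the same dimension. -/
theorem exists_of_symm_of_annihilates {S T : Type*} [AddCommGroup S] [Module ℝ S]
    [FiniteDimensional ℝ S] [AddCommGroup T] [Module ℝ T] [FiniteDimensional ℝ T]
    (hdim : Module.finrank ℝ S = Module.finrank ℝ T) (Θ : S →ₗ[ℝ] T)
    (Θ' : S →ₗ[ℝ] Module.Dual ℝ T) (hsymm : ∀ u w, Θ' w (Θ u) = Θ' u (Θ w))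
    (hker : ∀ u, Θ u = 0 → Θ' u = 0 → u = 0) (t : T) (ht : ∀ w, Θ w = 0 → Θ' w t = 0) :
    ∃ u, Θ u = t := by
  let Φ : Submodule ℝ (Module.Dual ℝ T) := (LinearMap.ker Θ).map Θ'
  have hΦ : Module.finrank ℝ Φ = Module.finrank ℝ (LinearMap.ker Θ) := by
    have hinj : Function.Injective (Θ'.domRestrict (LinearMap.ker Θ)) := by
      rw [injective_iff_map_eq_zero]
      exact fun u hu => Subtype.ext (hker u u.2 hu)
    rw [← LinearMap.finrank_range_of_inj hinj, LinearMap.range_domRestrict]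
  have hle : LinearMap.range Θ ≤ Φ.dualCoannihilator := by
    rintro _ ⟨u, rfl⟩
    rw [Submodule.mem_dualCoannihilator]
    rintro _ ⟨w, hw, rfl⟩
    rw [hsymm, LinearMap.mem_ker.1 hw, map_zero]
  have h1 := Subspace.finrank_add_finrank_dualCoannihilator_eq Φ
  have h2 := Θ.finrank_range_add_finrank_ker
  have heq := Submodule.eq_of_le_of_finrank_eq hle (by omega)
  have hmem : t ∈ Φ.dualCoannihilator := by
    rw [Submodule.mem_dualCoannihilator]
    rintro _ ⟨w, hw, rfl⟩
    exact ht w hw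
  rw [← heq] at hmem
  exact hmem

/-- The symplectic form on Cauchy data `(a, b)` is unchanged when the `U`-components of `a` and `b`
are exchanged up to sign, that is, under passage to the data adapted to the boundary condition
`a ∈ U`, `b ∈ Uᗮ`. -/
theorem inner_starProjection_comm {V : Type*} [NormedAddCommGroup V] [InnerProductSpace ℝ V]
    [FiniteDimensional ℝ V] (U : Submodule ℝ V) (a b a' b' : V) :
    inner ℝ (b' - U.starProjection b' + U.starProjection a')
        (a - U.starProjection a - U.starProjection b) -
      inner ℝ (b - U.starProjection b + U.starProjection a)
        (a' - U.starProjection a' - U.starProjection b') = inner ℝ b' a - inner ℝ b a' := by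
  have h : ∀ x y, inner ℝ (U.starProjection x) y = inner ℝ x (U.starProjection y) :=
    fun x y => Submodule.inner_starProjection_left_eq_right U x y
  have h2 : ∀ x, U.starProjection (U.starProjection x) = U.starProjection x := fun x =>
    Submodule.starProjection_eq_self_iff.2 (Submodule.starProjection_apply_mem _ _)
  simp only [inner_add_left, inner_sub_left, inner_sub_right, h, h2]
  have h3 : inner ℝ b' (U.starProjection a) = inner ℝ a (U.starProjection b') := by
    rw [← h, real_inner_comm]
  have h4 : inner ℝ b (U.starProjection a') = inner ℝ a' (U.starProjection b) := by
    rw [← h, real_inner_comm]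
  rw [h3, h4]
  ring

/-! ### Solutions and Green's formula on a network -/

namespace Network

theorem ext01_restrict_eqOn (v : ℝ → ℝ) :
    EqOn (ext01 fun t : unitInterval => v t) v (Icc 0 1) :=
  fun t ht => ext01_apply (fun t : unitInterval => v t) ⟨t, ht⟩

theorem mem_sobolevFun_of_smooth {ι : Type*} (u : smoothFun ι) : u.1 ∈ sobolevFun ι :=
  fun j => mem_sobolevInterval_of_contDiffOn (u.2 j)

variable {ι : Type*} (N : Network ι)

theorem endpoint_mem (h : ι × Bool) : (N.curve h.1).endpoint h.2 ∈ N.P ∪ N.Q := by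
  rw [N.endpoints]
  exact ⟨h.1, h.2, rfl⟩

theorem opL_eq_zero_iff {d : ι → ℝ → ℝ} {u : smoothFun ι} : N.opL d u = 0 ↔
    ∀ j, ∀ t ∈ Icc (0 : ℝ) 1, (N.curve j).arcDeriv ((N.curve j).arcDeriv (ext01 (u.1 j))) t +
      d j t * ext01 (u.1 j) t = 0 := by
  constructor
  · intro h j t ht
    have h0 : ext01 (u.1 j) t = u.1 j ⟨t, ht⟩ := ext01_apply (u.1 j) ⟨t, ht⟩
    rw [h0]
    exact congrFun (congrFun h j) ⟨t, ht⟩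
  · intro h
    funext j t
    have h1 := h j t t.2
    rwa [ext01_apply] at h1

theorem trace_eq_zero_iff {S : Set E3} {u : NetFun ι} : N.trace S u = 0 ↔
    ∀ h : ι × Bool, (N.curve h.1).endpoint h.2 ∈ S → u h.1 (endParam h.2) = 0 := by
  constructor
  · intro h0 h hh
    exact congrArg (fun v : N.V S => v ⟨h, hh⟩) h0
  · intro h0
    ext h
    exact h0 h.1 h.2

theorem trace_eq_zero_mono {S S' : Set E3} (h : S ⊆ S') {u : NetFun ι} (hu : N.trace S' u = 0) :
    N.trace S u = 0 :=
  N.trace_eq_zero_iff.2 fun e he => N.trace_eq_zero_iff.1 hu e (h he)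

theorem trace_Q_eq_zero {S : Set E3} {u : NetFun ι}
    (h1 : N.trace S u = 0) (h2 : N.trace (N.Q \ S) u = 0) : N.trace N.Q u = 0 := by
  rw [N.trace_eq_zero_iff] at *
  intro h hh
  by_cases hS : (N.curve h.1).endpoint h.2 ∈ S
  · exact h1 h hS
  · exact h2 h ⟨hh, hS⟩

/-- The values and outward derivatives of a function at the initial ends of the curves. -/
def initialData : smoothFun ι →ₗ[ℝ] (ι → ℝ × ℝ) where
  toFun u j := (N.trace univ u.1 ⟨(j, false), mem_univ _⟩,
    N.normalDeriv univ u ⟨(j, false), mem_univ _⟩)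
  map_add' u v := by
    funext j
    simp
  map_smul' c u := by
    funext j
    simp

theorem initialData_apply (u : smoothFun ι) (j : ι) :
    N.initialData u j = (ext01 (u.1 j) 0, -(N.curve j).arcDeriv (ext01 (u.1 j)) 0) := by
  have h0 : ext01 (u.1 j) 0 = u.1 j 0 := ext01_apply (u.1 j) 0
  rw [h0]
  refine Prod.ext rfl ?_
  have h : (N.initialData u j).2 = -1 * (N.curve j).arcDeriv (ext01 (u.1 j)) 0 := rfl
  rw [h, neg_one_mul]

section InitialValue

variable {N} {d : ι → ℝ → ℝ}

theorem eq_zero_of_initialData (hd : ∀ j, ContDiffOn ℝ ∞ (d j) (Icc 0 1)) {u : smoothFun ι}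
    (hL : N.opL d u = 0) (h : N.initialData u = 0) : u = 0 := by
  refine Subtype.ext (funext fun j => funext fun t => ?_)
  have h1 := congrFun h j
  rw [initialData_apply, Pi.zero_apply, Prod.mk_eq_zero, neg_eq_zero] at h1
  have h2 := (N.curve j).eq_zero_of_solution (hd j) (u.2 j) (N.opL_eq_zero_iff.1 hL j) h1.1 h1.2
    t t.2
  rwa [ext01_apply] at h2

theorem exists_initialData_eq (hd : ∀ j, ContDiffOn ℝ ∞ (d j) (Icc 0 1)) (x : ι → ℝ × ℝ) :
    ∃ u : smoothFun ι, N.opL d u = 0 ∧ N.initialData u = x := by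
  choose v hv h0 h0' hL using fun j =>
    (N.curve j).exists_solution (hd j) (x j).1 (-(x j).2)
  have hext : ∀ j, EqOn (ext01 fun t : unitInterval => v j t) (v j) (Icc 0 1) :=
    fun j => ext01_restrict_eqOn (v j)
  have harc : ∀ j, EqOn ((N.curve j).arcDeriv (ext01 fun t : unitInterval => v j t))
      ((N.curve j).arcDeriv (v j)) (Icc 0 1) :=
    fun j t ht => (N.curve j).arcDeriv_congr (hext j) ht
  refine ⟨⟨fun j t => v j t, fun j => (hv j).congr (hext j)⟩, ?_, ?_⟩
  · rw [N.opL_eq_zero_iff]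
    intro j t ht
    rw [hext j ht, (N.curve j).arcDeriv_congr (harc j) ht]
    exact hL j t ht
  · funext j
    rw [initialData_apply]
    simp only [hext j (left_mem_Icc.2 zero_le_one), harc j (left_mem_Icc.2 zero_le_one), h0, h0',
      neg_neg]

end InitialValue

variable [Fintype ι]

open Classical in
theorem sum_endsAt (A : Set E3) (F : ι × Bool → ℝ) :
    ∑ h : N.EndsAt A, F h.1 = ∑ h, if (N.curve h.1).endpoint h.2 ∈ A then F h else 0 := by
  rw [← Finset.sum_filter]
  exact (Finset.sum_subtype _ (fun h => by simp) F).symm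

/-- Every end of a curve lies in exactly one of `P`, `S` and `Q \ S`. -/
theorem sum_ends {S : Set E3} (hS : S ⊆ N.Q) (F : ι × Bool → ℝ) :
    ∑ h, F h = ∑ h : N.EndsAt N.P, F h.1 +
      (∑ h : N.EndsAt S, F h.1 + ∑ h : N.EndsAt (N.Q \ S), F h.1) := by
  classical
  rw [sum_endsAt, sum_endsAt, sum_endsAt, ← Finset.sum_add_distrib, ← Finset.sum_add_distrib]
  refine Finset.sum_congr rfl fun h _ => ?_
  have h2 : (N.curve h.1).endpoint h.2 ∈ N.P → (N.curve h.1).endpoint h.2 ∉ N.Q :=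
    fun hp hq => disjoint_left.1 N.disjoint hp hq
  have h3 := @hS ((N.curve h.1).endpoint h.2)
  rcases N.endpoint_mem h with h1 | h1
  · have h4 := h2 h1
    have h5 : (N.curve h.1).endpoint h.2 ∉ S := fun h5 => h4 (h3 h5)
    simp [h1, h4, h5]
  · have h4 : (N.curve h.1).endpoint h.2 ∉ N.P := fun h4 => h2 h4 h1
    by_cases h5 : (N.curve h.1).endpoint h.2 ∈ S <;> simp [h1, h4, h5]

theorem form_comm (d : ι → ℝ → ℝ) (u v : NetFun ι) : N.form d u v = N.form d v u :=
  Finset.sum_congr rfl fun _ _ => SphereCurve.curveForm_comm _ _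

/-- Green's formula on a network. -/
theorem form_eq_inner {d : ι → ℝ → ℝ} {S : Set E3} (hS : S ⊆ N.Q) {u : smoothFun ι}
    (hL : N.opL d u = 0) {v : NetFun ι} (hv : v ∈ sobolevFun ι) :
    N.form d u.1 v = inner ℝ (N.normalDeriv N.P u) (N.trace N.P v) +
      (inner ℝ (N.normalDeriv S u) (N.trace S v) +
        inner ℝ (N.normalDeriv (N.Q \ S) u) (N.trace (N.Q \ S) v)) := by
  have h1 : N.form d u.1 v = ∑ h : ι × Bool, v h.1 (endParam h.2) *
      (endSign h.2 * (N.curve h.1).arcDeriv (ext01 (u.1 h.1)) (endParam h.2)) := by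
    rw [Fintype.sum_prod_type]
    refine Finset.sum_congr rfl fun j _ => ?_
    refine (SphereCurve.curveForm_eq_boundary (u.2 j) (N.opL_eq_zero_iff.1 hL j) (hv j)).trans ?_
    have h0 : ext01 (v j) 0 = v j 0 := ext01_apply (v j) 0
    have h1 : ext01 (v j) 1 = v j 1 := ext01_apply (v j) 1
    simp only [Fintype.sum_bool, endParam, endSign, h0, h1, if_true, Bool.false_eq_true, if_false,
      Icc.coe_zero, Icc.coe_one]
    ring
  rw [h1, N.sum_ends hS]
  rfl

/-- Green's formula for a solution satisfying the compatibility condition at `P`. -/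
theorem form_eq_inner_of_mem {d : ι → ℝ → ℝ} {S : Set E3} (hS : S ⊆ N.Q) {u : smoothFun ι}
    (hL : N.opL d u = 0) (hu : N.normalDeriv N.P u ∈ N.V2 N.P) {v : NetFun ι}
    (hv : v ∈ sobolevFun ι) (hvP : N.trace N.P v ∈ N.V1 N.P) (hvQ : N.trace (N.Q \ S) v = 0) :
    N.form d u.1 v = inner ℝ (N.normalDeriv S u) (N.trace S v) := by
  rw [N.form_eq_inner hS hL hv, hvQ, inner_zero_right,
    (Submodule.mem_orthogonal' _ _).1 hu _ hvP]
  ring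

variable {N} {d : ι → ℝ → ℝ}

/-- The solutions of `L u = 0` are parametrized by their initial data. -/
def solutionEquiv (N : Network ι) (hd : ∀ j, ContDiffOn ℝ ∞ (d j) (Icc 0 1)) :
    LinearMap.ker (N.opL d) ≃ₗ[ℝ] (ι → ℝ × ℝ) :=
  LinearEquiv.ofBijective (N.initialData.domRestrict (LinearMap.ker (N.opL d))) <| by
    constructor
    · rw [injective_iff_map_eq_zero]
      exact fun u hu => Subtype.ext (eq_zero_of_initialData hd u.2 hu)
    · intro x
      obtain ⟨u, hu, hx⟩ := exists_initialData_eq (N := N) hd x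
      exact ⟨⟨u, hu⟩, hx⟩

theorem mem_nullSpace {u : smoothFun ι} : u ∈ N.nullSpace d ↔
    N.opL d u = 0 ∧ N.trace N.Q u.1 = 0 ∧ N.trace N.P u.1 ∈ N.V1 N.P ∧
      N.normalDeriv N.P u ∈ N.V2 N.P := by
  simp only [nullSpace, Submodule.mem_inf, LinearMap.mem_ker, Submodule.mem_comap, and_assoc]
  rfl

theorem finrank_boundary {S : Set E3} (hS : S ⊆ N.Q) :
    Module.finrank ℝ (N.V N.P × N.V S × N.V (N.Q \ S)) = Fintype.card ι * 2 := by
  have h := N.sum_ends hS (fun _ => 1)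
  simp only [Finset.sum_const, nsmul_eq_mul, mul_one, Finset.card_univ, Fintype.card_prod,
    Fintype.card_bool] at h
  rw [Module.finrank_prod, Module.finrank_prod, finrank_euclideanSpace, finrank_euclideanSpace,
    finrank_euclideanSpace]
  exact_mod_cast h.symm

/-- Solvability of the extension problem without the normalization of the Neumann data. -/
theorem exists_solution_trace_eq (hd : ∀ j, ContDiffOn ℝ ∞ (d j) (Icc 0 1)) {S : Set E3}
    (hS : S ⊆ N.Q) {g : N.V S} (hg : g ∈ (N.neumannNull d S)ᗮ) :
    ∃ u : smoothFun ι, N.opL d u = 0 ∧ N.trace S u.1 = g ∧ N.trace (N.Q \ S) u.1 = 0 ∧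
      N.trace N.P u.1 ∈ N.V1 N.P ∧ N.normalDeriv N.P u ∈ N.V2 N.P := by
  let e := N.solutionEquiv hd
  have : FiniteDimensional ℝ (LinearMap.ker (N.opL d)) := e.symm.finiteDimensional
  let Sol := LinearMap.ker (N.opL d)
  let tr : (A : Set E3) → Sol →ₗ[ℝ] N.V A := fun A =>
    N.trace A ∘ₗ (smoothFun ι).subtype ∘ₗ Sol.subtype
  let nd : (A : Set E3) → Sol →ₗ[ℝ] N.V A := fun A => N.normalDeriv A ∘ₗ Sol.subtype
  let p : N.V N.P →ₗ[ℝ] N.V N.P := (N.V1 N.P).starProjection.toLinearMap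
  -- At `P`, the `V₂`-component of the trace and the `V₁`-component of the Neumann data have to
  -- vanish; as the two components are orthogonal, their difference records both in one vector.
  let Θ : Sol →ₗ[ℝ] N.V N.P × N.V S × N.V (N.Q \ S) :=
    (tr N.P - p ∘ₗ tr N.P - p ∘ₗ nd N.P).prod ((tr S).prod (tr (N.Q \ S)))
  let Θ' : Sol →ₗ[ℝ] Module.Dual ℝ (N.V N.P × N.V S × N.V (N.Q \ S)) :=
    (LinearMap.compl₁₂ (innerₗ (N.V N.P)) (nd N.P - p ∘ₗ nd N.P + p ∘ₗ tr N.P)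
      (LinearMap.fst ℝ _ _)) +
    ((LinearMap.compl₁₂ (innerₗ (N.V S)) (nd S) (LinearMap.fst ℝ _ _ ∘ₗ LinearMap.snd ℝ _ _)) +
    (LinearMap.compl₁₂ (innerₗ (N.V (N.Q \ S))) (nd (N.Q \ S))
      (LinearMap.snd ℝ _ _ ∘ₗ LinearMap.snd ℝ _ _)))
  have hΘ' : ∀ w x y z, Θ' w (x, y, z) =
      inner ℝ (nd N.P w - p (nd N.P w) + p (tr N.P w)) x +
        (inner ℝ (nd S w) y + inner ℝ (nd (N.Q \ S) w) z) := fun w x y z => rfl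
  have hΘ : ∀ u, Θ u = (tr N.P u - p (tr N.P u) - p (nd N.P u), tr S u, tr (N.Q \ S) u) :=
    fun u => rfl
  have hpmem : ∀ x, p x ∈ N.V1 N.P := fun x => Submodule.starProjection_apply_mem _ _
  have hpp : ∀ x, p (p x) = p x := fun x => Submodule.starProjection_eq_self_iff.2 (hpmem x)
  have hker : ∀ u, Θ u = 0 → tr N.P u ∈ N.V1 N.P ∧ p (nd N.P u) = 0 ∧ tr S u = 0 ∧
      tr (N.Q \ S) u = 0 := by
    intro u hu
    rw [hΘ, Prod.mk_eq_zero, Prod.mk_eq_zero] at hu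
    have h1 : p (nd N.P u) = 0 := by
      have := congrArg p hu.1
      simpa only [map_sub, hpp, sub_self, zero_sub, map_zero, neg_eq_zero] using this
    refine ⟨?_, h1, hu.2.1, hu.2.2⟩
    have h2 := hu.1
    rw [h1, sub_zero, sub_eq_zero] at h2
    rw [h2]
    exact hpmem _
  have hV2 : ∀ x, p x = 0 → x ∈ N.V2 N.P := fun x hx =>
    (Submodule.starProjection_apply_eq_zero_iff _).1 hx
  have hdim : Module.finrank ℝ Sol = Module.finrank ℝ (N.V N.P × N.V S × N.V (N.Q \ S)) := by
    rw [e.finrank_eq, finrank_boundary hS, Module.finrank_pi_fintype]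
    simp
  have hsymm : ∀ u w, Θ' w (Θ u) = Θ' u (Θ w) := by
    intro u w
    rw [hΘ, hΘ, hΘ', hΘ']
    have h1 := N.form_comm d u.1.1 w.1.1
    rw [N.form_eq_inner hS u.2 (mem_sobolevFun_of_smooth w.1),
      N.form_eq_inner hS w.2 (mem_sobolevFun_of_smooth u.1)] at h1
    have h2 := inner_starProjection_comm (N.V1 N.P) (tr N.P u) (nd N.P u) (tr N.P w) (nd N.P w)
    simp only [tr, nd, p, LinearMap.comp_apply, Submodule.subtype_apply,
      ContinuousLinearMap.coe_coe] at h1 h2 ⊢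
    linarith
  have hinj : ∀ u, Θ u = 0 → Θ' u = 0 → u = 0 := by
    intro u hu hu'
    obtain ⟨h1, h2, h3, h4⟩ := hker u hu
    have h5 : ∀ x y z, inner ℝ (nd N.P u - p (nd N.P u) + p (tr N.P u)) x +
        (inner ℝ (nd S u) y + inner ℝ (nd (N.Q \ S) u) z) = 0 := fun x y z => by
      rw [← hΘ', hu', LinearMap.zero_apply]
    have h6 : nd N.P u + tr N.P u = 0 := by
      have h7 := h5 (nd N.P u + tr N.P u) 0 0
      have h8 : p (tr N.P u) = tr N.P u := Submodule.starProjection_eq_self_iff.2 h1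
      rw [h2, h8, sub_zero, inner_zero_right, inner_zero_right, add_zero, add_zero] at h7
      exact inner_self_eq_zero.1 h7
    have hnP : nd N.P u = 0 := by
      have h7 : p (nd N.P u + tr N.P u) = tr N.P u := by
        rw [map_add, h2, zero_add]
        exact Submodule.starProjection_eq_self_iff.2 h1
      rw [h6, map_zero] at h7
      rwa [← h7, add_zero] at h6
    have htP : tr N.P u = 0 := by rwa [hnP, zero_add] at h6
    have hnS : nd S u = 0 := by
      have h7 := h5 0 (nd S u) 0
      rw [inner_zero_right, inner_zero_right, add_zero, zero_add] at h7
      exact inner_self_eq_zero.1 h7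
    have hnQ : nd (N.Q \ S) u = 0 := by
      have h7 := h5 0 0 (nd (N.Q \ S) u)
      rw [inner_zero_right, inner_zero_right, zero_add, zero_add] at h7
      exact inner_self_eq_zero.1 h7
    -- all Cauchy data vanish
    refine Subtype.ext (eq_zero_of_initialData hd u.2 (funext fun j => ?_))
    have hcase : ∀ A : Set E3, tr A u = 0 → nd A u = 0 → (N.curve j).endpoint false ∈ A →
        N.initialData u.1 j = 0 := by
      intro A hA hA' hj
      exact Prod.ext (congrArg (fun v : N.V A => v ⟨(j, false), hj⟩) hA)
        (congrArg (fun v : N.V A => v ⟨(j, false), hj⟩) hA')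
    rcases N.endpoint_mem (j, false) with hj | hj
    · exact hcase _ htP hnP hj
    · by_cases hj' : (N.curve j).endpoint false ∈ S
      · exact hcase _ h3 hnS hj'
      · exact hcase _ h4 hnQ ⟨hj, hj'⟩
  have hann : ∀ w, Θ w = 0 → Θ' w (0, g, 0) = 0 := by
    intro w hw
    obtain ⟨h1, h2, h3, h4⟩ := hker w hw
    rw [hΘ', inner_zero_right, inner_zero_right, zero_add, add_zero]
    refine (Submodule.mem_orthogonal _ _).1 hg _ ⟨w.1, ?_, rfl⟩
    exact mem_nullSpace.2 ⟨w.2, N.trace_Q_eq_zero h3 h4, h1, hV2 _ h2⟩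
  obtain ⟨u, hu⟩ := exists_of_symm_of_annihilates (S := Sol) hdim Θ Θ' hsymm hinj (0, g, 0) hann
  rw [hΘ, Prod.mk.injEq, Prod.mk.injEq] at hu
  obtain ⟨hu1, hu2, hu3⟩ := hu
  have h1 : p (nd N.P u) = 0 := by
    have := congrArg p hu1
    simpa only [map_sub, hpp, sub_self, zero_sub, map_zero, neg_eq_zero] using this
  rw [h1, sub_zero, sub_eq_zero] at hu1
  refine ⟨u.1, u.2, hu2, hu3, ?_, hV2 _ h1⟩
  have h2 := hpmem (tr N.P u)
  rwa [← hu1] at h2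

/-! ### The Dirichlet-to-Neumann map -/

/-- The Neumann data of a solution with the given trace is normalized by subtracting a null
function, which does not change the trace. -/
theorem exists_isExtension (hd : ∀ j, ContDiffOn ℝ ∞ (d j) (Icc 0 1)) {S : Set E3}
    (hS : S ⊆ N.Q) {g : N.V S} (hg : g ∈ (N.neumannNull d S)ᗮ) :
    ∃ u, N.IsExtension d S g u := by
  obtain ⟨u, h1, h2, h3, h4, h5⟩ := exists_solution_trace_eq hd hS hg
  obtain ⟨w, hw, hw'⟩ : (N.neumannNull d S).starProjection (N.normalDeriv S u) ∈
    N.neumannNull d S := Submodule.starProjection_apply_mem _ _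
  obtain ⟨w1, w2, w3, w4⟩ := mem_nullSpace.1 hw
  have hwS : N.trace S w.1 = 0 := N.trace_eq_zero_mono hS w2
  have hwQ : N.trace (N.Q \ S) w.1 = 0 := N.trace_eq_zero_mono sdiff_subset w2
  have hsub : (u - w).1 = u.1 - w.1 := rfl
  refine ⟨u - w, ?_, ?_, ?_, ?_, ?_, ?_⟩
  · rw [map_sub, h1, w1, sub_zero]
  · rw [hsub, map_sub, h2, hwS, sub_zero]
  · rw [hsub, map_sub, h3, hwQ, sub_zero]
  · rw [hsub, map_sub]
    exact Submodule.sub_mem _ h4 w3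
  · rw [map_sub]
    exact Submodule.sub_mem _ h5 w4
  · rw [map_sub, hw']
    exact Submodule.sub_starProjection_mem_orthogonal _

theorem normalDeriv_eq_of_isExtension {S : Set E3} {g : N.V S} {u w : smoothFun ι}
    (hu : N.IsExtension d S g u) (hw : N.IsExtension d S g w) :
    N.normalDeriv S u = N.normalDeriv S w := by
  obtain ⟨u1, u2, u3, u4, u5, u6⟩ := hu
  obtain ⟨w1, w2, w3, w4, w5, w6⟩ := hw
  have hsub : (u - w).1 = u.1 - w.1 := rfl
  have hnull : u - w ∈ N.nullSpace d := by
    refine mem_nullSpace.2 ⟨by rw [map_sub, u1, w1, sub_zero], ?_, ?_, ?_⟩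
    · refine N.trace_Q_eq_zero (S := S) ?_ ?_
      · rw [hsub, map_sub, u2, w2, sub_self]
      · rw [hsub, map_sub, u3, w3, sub_self]
    · rw [hsub, map_sub]
      exact Submodule.sub_mem _ u4 w4
    · rw [map_sub]
      exact Submodule.sub_mem _ u5 w5
  have h1 : N.normalDeriv S (u - w) ∈ N.neumannNull d S := ⟨_, hnull, rfl⟩
  have h2 : N.normalDeriv S (u - w) ∈ (N.neumannNull d S)ᗮ := by
    rw [map_sub]
    exact Submodule.sub_mem _ u6 w6
  have h3 := inner_self_eq_zero.1 ((Submodule.mem_orthogonal _ _).1 h2 _ h1)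
  rwa [map_sub, sub_eq_zero] at h3

theorem isExtension_add {S : Set E3} {g g' : N.V S} {u u' : smoothFun ι}
    (hu : N.IsExtension d S g u) (hu' : N.IsExtension d S g' u') :
    N.IsExtension d S (g + g') (u + u') := by
  obtain ⟨u1, u2, u3, u4, u5, u6⟩ := hu
  obtain ⟨w1, w2, w3, w4, w5, w6⟩ := hu'
  have hadd : (u + u').1 = u.1 + u'.1 := rfl
  refine ⟨by rw [map_add, u1, w1, add_zero], by rw [hadd, map_add, u2, w2],
    by rw [hadd, map_add, u3, w3, add_zero], ?_, ?_, ?_⟩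
  · rw [hadd, map_add]
    exact Submodule.add_mem _ u4 w4
  · rw [map_add]
    exact Submodule.add_mem _ u5 w5
  · rw [map_add]
    exact Submodule.add_mem _ u6 w6

theorem isExtension_smul {S : Set E3} {g : N.V S} {u : smoothFun ι} (c : ℝ)
    (hu : N.IsExtension d S g u) : N.IsExtension d S (c • g) (c • u) := by
  obtain ⟨u1, u2, u3, u4, u5, u6⟩ := hu
  have hsmul : (c • u).1 = c • u.1 := rfl
  refine ⟨by rw [map_smul, u1, smul_zero], by rw [hsmul, map_smul, u2],
    by rw [hsmul, map_smul, u3, smul_zero], ?_, ?_, ?_⟩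
  · rw [hsmul, map_smul]
    exact Submodule.smul_mem _ _ u4
  · rw [map_smul]
    exact Submodule.smul_mem _ _ u5
  · rw [map_smul]
    exact Submodule.smul_mem _ _ u6

theorem isDirichletToNeumann_dirichletToNeumann (hd : ∀ j, ContDiffOn ℝ ∞ (d j) (Icc 0 1))
    {S : Set E3} (hS : S ⊆ N.Q) : N.IsDirichletToNeumann d S (N.dirichletToNeumann d S) := by
  have hex : ∃ T, N.IsDirichletToNeumann d S T := by
    choose u hu using fun g : (N.neumannNull d S)ᗮ => exists_isExtension hd hS g.2
    refine ⟨{ toFun := fun g => ⟨N.normalDeriv S (u g), (hu g).2.2.2.2.2⟩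
              map_add' := fun g g' => Subtype.ext ?_
              map_smul' := fun c g => Subtype.ext ?_ }, fun g => ⟨⟨u g, hu g⟩, fun w hw => ?_⟩⟩
    · exact (normalDeriv_eq_of_isExtension (hu (g + g'))
        (isExtension_add (hu g) (hu g'))).trans (map_add _ _ _)
    · exact (normalDeriv_eq_of_isExtension (hu (c • g))
        (isExtension_smul c (hu g))).trans (map_smul _ _ _)
    · exact normalDeriv_eq_of_isExtension hw (hu g)
  rw [dirichletToNeumann, dif_pos hex]
  exact hex.choose_spec

/-! ### The index of a network -/

/-- The space `W^{1,2}_{0,1}`. -/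
def sobolevSpace (N : Network ι) : Submodule ℝ (NetFun ι) where
  carrier := N.sobolev01
  add_mem' := by
    rintro u v ⟨hu, hu1, hu2⟩ ⟨hv, hv1, hv2⟩
    refine ⟨fun j => sobolevInterval.add_mem (hu j) (hv j), ?_, ?_⟩
    · rw [map_add]
      exact Submodule.add_mem _ hu1 hv1
    · rw [map_add, hu2, hv2, add_zero]
  zero_mem' := ⟨fun _ => sobolevInterval.zero_mem, by rw [map_zero]; exact Submodule.zero_mem _,
    map_zero _⟩
  smul_mem' := by
    rintro c u ⟨hu, hu1, hu2⟩
    refine ⟨fun j => sobolevInterval.smul_mem c (hu j), ?_, ?_⟩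
    · rw [map_smul]
      exact Submodule.smul_mem _ _ hu1
    · rw [map_smul, hu2, smul_zero]

/-- The form `ℒ` as a bilinear form on `W^{1,2}_{0,1}`. -/
def formBilin (N : Network ι) (hd : ∀ j, ContDiffOn ℝ ∞ (d j) (Icc 0 1)) :
    LinearMap.BilinForm ℝ N.sobolevSpace :=
  have hadd : ∀ u v w : N.sobolevSpace,
      N.form d (u + v).1 w.1 = N.form d u.1 w.1 + N.form d v.1 w.1 := fun u v w => by
    refine (Finset.sum_congr rfl fun j _ => ?_).trans Finset.sum_add_distrib
    exact SphereCurve.curveForm_add_left (hd j) (u.2.1 j) (v.2.1 j) (w.2.1 j)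
  have hsmul : ∀ (c : ℝ) (u w : N.sobolevSpace),
      N.form d (c • u).1 w.1 = c * N.form d u.1 w.1 := fun c u w => by
    refine (Finset.sum_congr rfl fun j _ => ?_).trans (Finset.mul_sum _ _ _).symm
    exact SphereCurve.curveForm_smul_left c (u.2.1 j)
  LinearMap.mk₂ ℝ (fun u v => N.form d u.1 v.1) hadd hsmul
    (fun u v w => by rw [N.form_comm, hadd, N.form_comm d v.1, N.form_comm d w.1])
    (fun c u w => by rw [N.form_comm, hsmul, N.form_comm d w.1, smul_eq_mul])

theorem formBilin_apply (hd : ∀ j, ContDiffOn ℝ ∞ (d j) (Icc 0 1)) (u v : N.sobolevSpace) :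
    N.formBilin hd u v = N.form d u.1 v.1 := rfl

theorem formBilin_comm (hd : ∀ j, ContDiffOn ℝ ∞ (d j) (Icc 0 1)) (u v : N.sobolevSpace) :
    N.formBilin hd u v = N.formBilin hd v u := N.form_comm d _ _

theorem exists_hasMorseIndex_formBilin (N : Network ι)
    (hd : ∀ j, ContDiffOn ℝ ∞ (d j) (Icc 0 1)) : ∃ n, HasMorseIndex (N.formBilin hd) n := by
  choose m ψ hψ using fun j => (N.curve j).exists_curveForm_nonneg (hd j)
  let Ψ : N.sobolevSpace →ₗ[ℝ] ((j : ι) → Fin (m j) → ℝ) :=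
    (LinearMap.pi fun j => ψ j ∘ₗ LinearMap.proj j) ∘ₗ N.sobolevSpace.subtype
  refine exists_hasMorseIndex (formBilin_comm hd) Ψ fun u hu => ?_
  exact Finset.sum_nonneg fun j _ => hψ j _ (u.2.1 j) (congrFun hu j)

theorem index_eq_of_hasMorseIndex {hd : ∀ j, ContDiffOn ℝ ∞ (d j) (Icc 0 1)} {n : ℕ}
    (h : HasMorseIndex (N.formBilin hd) n) : N.index d = n := by
  refine le_antisymm (iSup_le fun W => iSup₂_le fun hW hneg => ?_) ?_
  · have hW' : W ≤ N.sobolevSpace := hW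
    have h1 := h.rank_le (W.comap N.sobolevSpace.subtype) (fun w hw hne =>
      hneg w hw (by simpa using hne))
    rw [(Submodule.comapSubtypeEquivOfLe hW').rank_eq] at h1
    have h2 := Cardinal.toENat.monotone' h1
    simpa using h2
  · obtain ⟨W, hneg, hr⟩ := h.exists_submodule
    refine le_iSup_of_le (W.map N.sobolevSpace.subtype) (le_iSup₂_of_le ?_ ?_ ?_)
    · rintro _ ⟨w, -, rfl⟩
      exact w.2
    · rintro _ ⟨w, hw, rfl⟩ hne
      exact hneg w hw (fun h0 => hne (by simp [h0]))
    · rw [← (Submodule.equivSubtypeMap N.sobolevSpace W).rank_eq, hr]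
      simp

end Network

/-! ### Restriction to the subnetworks of a partition and gluing -/

namespace Network

namespace Partition

variable {ι : Type*} {N : Network ι} {l : ℕ} (p : N.Partition l)

/-- Restriction of a function to the `i`-th subnetwork. -/
def restrict (i : Fin l) : NetFun ι →ₗ[ℝ] NetFun {j // p.part j = i} where
  toFun u j := u j.1
  map_add' _ _ := rfl
  map_smul' _ _ := rfl

/-- The function on the network with given restrictions to the subnetworks. -/
def glueFun : ((i : Fin l) → NetFun {j // p.part j = i}) →ₗ[ℝ] NetFun ι where
  toFun w j := w (p.part j) ⟨j, rfl⟩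
  map_add' _ _ := rfl
  map_smul' _ _ := rfl

/-- Restriction of a smooth function to the `i`-th subnetwork. -/
def restrictSmooth (i : Fin l) : smoothFun ι →ₗ[ℝ] smoothFun {j // p.part j = i} where
  toFun u := ⟨p.restrict i u.1, fun j => u.2 j.1⟩
  map_add' _ _ := rfl
  map_smul' _ _ := rfl

theorem restrict_glueFun (w : (i : Fin l) → NetFun {j // p.part j = i}) (i : Fin l) :
    p.restrict i (p.glueFun w) = w i := by
  funext ⟨j, hj⟩
  subst hj
  rfl

theorem exists_smooth_restrict_eq (w : (i : Fin l) → smoothFun {j // p.part j = i}) :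
    ∃ u : smoothFun ι, ∀ i, p.restrictSmooth i u = w i :=
  ⟨⟨p.glueFun fun i => (w i).1, fun j => (w (p.part j)).2 ⟨j, rfl⟩⟩,
    fun i => Subtype.ext (p.restrict_glueFun (fun i => (w i).1) i)⟩

theorem res_glue (f : (i : Fin l) → (p.sub i).V (p.Qcut i)) (i : Fin l) :
    p.res i (p.glue f) = f i := by
  ext ⟨⟨⟨j, hj⟩, b⟩, h⟩
  subst hj
  rfl

theorem glue_res (g : N.V p.Pcut) : p.glue (fun i => p.res i g) = g := rfl

theorem ext_res {g g' : N.V p.Pcut} (h : ∀ i, p.res i g = p.res i g') : g = g' := by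
  rw [← p.glue_res g, ← p.glue_res g', funext h]

theorem res_trace (i : Fin l) (u : NetFun ι) :
    p.res i (N.trace p.Pcut u) = (p.sub i).trace (p.Qcut i) (p.restrict i u) := rfl

theorem res_normalDeriv (i : Fin l) (u : smoothFun ι) :
    p.res i (N.normalDeriv p.Pcut u) =
      (p.sub i).normalDeriv (p.Qcut i) (p.restrictSmooth i u) := rfl

theorem mem_Psub_or {j : ι} (b : Bool) : (N.curve j).endpoint b ∈ p.Psub (p.part j) ∪
    (p.Qcut (p.part j) ∪ p.Qkeep (p.part j)) := by
  rw [p.sub_endpoints]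
  exact ⟨j, b, rfl, rfl⟩

theorem Psub_subset (i : Fin l) : p.Psub i ⊆ p.Pkeep := by
  rw [p.Pkeep_eq]
  exact subset_iUnion p.Psub i

theorem Qkeep_subset (i : Fin l) : p.Qkeep i ⊆ N.Q := by
  rw [p.Q_eq]
  exact subset_iUnion p.Qkeep i

theorem Pkeep_subset : p.Pkeep ⊆ N.P := by
  rw [← p.P_eq]
  exact subset_union_left

theorem Pcut_subset : p.Pcut ⊆ N.P := by
  rw [← p.P_eq]
  exact subset_union_right

/-- All curves ending at a kept interior end point belong to the same subnetwork. -/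
theorem part_eq_of_mem_Psub {i : Fin l} {j : ι} {b : Bool}
    (h : (N.curve j).endpoint b ∈ p.Psub i) : p.part j = i := by
  have hk := p.Psub_subset i h
  rcases p.mem_Psub_or (j := j) b with h1 | h1 | h1
  · by_contra hne
    exact disjoint_left.1 (p.Psub_disjoint hne) h1 h
  · exact absurd (p.Qcut_subset _ h1) (disjoint_left.1 p.P_disjoint hk)
  · exact absurd (p.Qkeep_subset _ h1) (disjoint_left.1 N.disjoint (p.Pkeep_subset hk))

theorem mem_Qkeep {j : ι} {b : Bool} (h : (N.curve j).endpoint b ∈ N.Q) :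
    (N.curve j).endpoint b ∈ p.Qkeep (p.part j) := by
  rcases p.mem_Psub_or (j := j) b with h1 | h1 | h1
  · exact absurd h (disjoint_left.1 N.disjoint (p.Pkeep_subset (p.Psub_subset _ h1)))
  · exact absurd h (disjoint_left.1 N.disjoint (p.Pcut_subset (p.Qcut_subset _ h1)))
  · exact h1

theorem sub_Q_diff (i : Fin l) : (p.sub i).Q \ p.Qcut i = p.Qkeep i := by
  change (p.Qcut i ∪ p.Qkeep i) \ p.Qcut i = p.Qkeep i
  rw [union_sdiff_left, sdiff_eq_left]
  exact (p.Q_disjoint i).symm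

theorem trace_Q_eq_zero_iff {u : NetFun ι} : N.trace N.Q u = 0 ↔
    ∀ i, (p.sub i).trace ((p.sub i).Q \ p.Qcut i) (p.restrict i u) = 0 := by
  constructor
  · intro h i
    rw [trace_eq_zero_iff] at h ⊢
    intro e he
    rw [p.sub_Q_diff] at he
    exact h (e.1.1, e.2) (p.Qkeep_subset i he)
  · intro h
    rw [trace_eq_zero_iff]
    intro e he
    have h1 := (p.sub (p.part e.1)).trace_eq_zero_iff.1 (h (p.part e.1)) (⟨e.1, rfl⟩, e.2)
    rw [p.sub_Q_diff] at h1
    exact h1 (p.mem_Qkeep he)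

theorem trace_mem_V1_iff {u : NetFun ι} : N.trace N.P u ∈ N.V1 N.P ↔
    (∀ i, (p.sub i).trace (p.Psub i) (p.restrict i u) ∈ (p.sub i).V1 (p.Psub i)) ∧
      N.trace p.Pcut u ∈ N.V1 p.Pcut := by
  constructor
  · intro h
    refine ⟨fun i x hx => ?_, fun x hx => ?_⟩
    · have hxP : x ∈ N.P := p.Pkeep_subset (p.Psub_subset i hx)
      obtain ⟨X, hX, hX'⟩ := h x hxP
      refine ⟨X, hX, fun e he => ?_⟩
      exact hX' ⟨(e.1.1.1, e.1.2), p.Pkeep_subset (p.Psub_subset i e.2)⟩ he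
    · obtain ⟨X, hX, hX'⟩ := h x (p.Pcut_subset hx)
      exact ⟨X, hX, fun e he => hX' ⟨e.1, p.Pcut_subset e.2⟩ he⟩
  · rintro ⟨h1, h2⟩ x hx
    rw [← p.P_eq] at hx
    rcases hx with hx | hx
    · rw [p.Pkeep_eq] at hx
      obtain ⟨i, hi⟩ := mem_iUnion.1 hx
      obtain ⟨X, hX, hX'⟩ := h1 i x hi
      refine ⟨X, hX, fun e he => ?_⟩
      have hei : (N.curve e.1.1).endpoint e.1.2 ∈ p.Psub i := he ▸ hi
      exact hX' ⟨(⟨e.1.1, p.part_eq_of_mem_Psub hei⟩, e.1.2), hei⟩ he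
    · obtain ⟨X, hX, hX'⟩ := h2 x hx
      refine ⟨X, hX, fun e he => ?_⟩
      have hei : (N.curve e.1.1).endpoint e.1.2 ∈ p.Pcut := he ▸ hx
      exact hX' ⟨e.1, hei⟩ he

theorem mem_sobolev01_iff {u : NetFun ι} : u ∈ N.sobolev01 ↔
    (∀ i, p.restrict i u ∈ sobolevFun _ ∧
      (p.sub i).trace (p.Psub i) (p.restrict i u) ∈ (p.sub i).V1 (p.Psub i) ∧
      (p.sub i).trace ((p.sub i).Q \ p.Qcut i) (p.restrict i u) = 0) ∧
    N.trace p.Pcut u ∈ N.V1 p.Pcut := by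
  constructor
  · rintro ⟨h1, h2, h3⟩
    have h2' := p.trace_mem_V1_iff.1 h2
    exact ⟨fun i => ⟨fun j => h1 j.1, h2'.1 i, p.trace_Q_eq_zero_iff.1 h3 i⟩, h2'.2⟩
  · rintro ⟨h1, h2⟩
    exact ⟨fun j => (h1 (p.part j)).1 ⟨j, rfl⟩, p.trace_mem_V1_iff.2 ⟨fun i => (h1 i).2.1, h2⟩,
      p.trace_Q_eq_zero_iff.2 fun i => (h1 i).2.2⟩

theorem trace_eq_zero_of_restrict {u : NetFun ι}
    (h : ∀ i, p.restrict i u ∈ (p.sub i).sobolev01) : N.trace p.Pcut u = 0 := by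
  refine p.ext_res fun i => ?_
  rw [map_zero, p.res_trace]
  exact (p.sub i).trace_eq_zero_mono subset_union_left (h i).2.2

/-- A function without trace at the cut points restricts to an admissible function on each
subnetwork. -/
theorem restrict_mem_sobolev01 {u : NetFun ι} (hu : u ∈ N.sobolev01)
    (h0 : N.trace p.Pcut u = 0) (i : Fin l) : p.restrict i u ∈ (p.sub i).sobolev01 := by
  obtain ⟨h1, h2, h3⟩ := (p.mem_sobolev01_iff.1 hu).1 i
  refine ⟨h1, h2, (p.sub i).trace_Q_eq_zero (S := p.Qcut i) ?_ h3⟩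
  rw [← p.res_trace, h0, map_zero]

theorem mem_sobolev01_of_restrict {u : NetFun ι}
    (h : ∀ i, p.restrict i u ∈ (p.sub i).sobolev01) : u ∈ N.sobolev01 := by
  refine p.mem_sobolev01_iff.2 ⟨fun i => ⟨(h i).1, (h i).2.1,
    (p.sub i).trace_eq_zero_mono sdiff_subset (h i).2.2⟩, ?_⟩
  rw [p.trace_eq_zero_of_restrict h]
  exact Submodule.zero_mem _

/-- The trace at the cut points maps `W^{1,2}_{0,1}` onto `V₁`. -/
theorem exists_mem_sobolev01_trace_eq {g : N.V p.Pcut} (hg : g ∈ N.V1 p.Pcut) :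
    ∃ u ∈ N.sobolev01, N.trace p.Pcut u = g := by
  classical
  let a : ι → Bool → ℝ := fun j b =>
    if h : (N.curve j).endpoint b ∈ p.Pcut then g ⟨(j, b), h⟩ else 0
  let v : ι → ℝ → ℝ := fun j t => (1 - t) * a j false + t * a j true
  let u : NetFun ι := fun j t => v j t
  have hu : ∀ e : ι × Bool, u e.1 (endParam e.2) = a e.1 e.2 := by
    rintro ⟨j, b⟩
    cases b <;> simp [u, v, endParam]
  have hzero : ∀ e : ι × Bool, (N.curve e.1).endpoint e.2 ∉ p.Pcut → u e.1 (endParam e.2) = 0 :=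
    fun e he => by rw [hu]; exact dif_neg he
  have htr : N.trace p.Pcut u = g := by
    ext e
    exact (hu e.1).trans (dif_pos e.2)
  refine ⟨u, p.mem_sobolev01_iff.2 ⟨fun i => ⟨fun j => ?_, ?_, ?_⟩, by rwa [htr]⟩, htr⟩
  · refine mem_sobolevInterval_of_contDiffOn (ContDiffOn.congr ?_ (ext01_restrict_eqOn (v j.1)))
    exact ContDiff.contDiffOn (by fun_prop)
  · have h0 : (p.sub i).trace (p.Psub i) (p.restrict i u) = 0 := by
      rw [trace_eq_zero_iff]
      exact fun e he => hzero (e.1.1, e.2) (disjoint_left.1 p.P_disjoint (p.Psub_subset i he))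
    rw [h0]
    exact Submodule.zero_mem _
  · rw [trace_eq_zero_iff]
    intro e he
    rw [p.sub_Q_diff] at he
    exact hzero (e.1.1, e.2) fun h =>
      disjoint_left.1 N.disjoint (p.Pcut_subset h) (p.Qkeep_subset i he)

/-- The ends of the subnetworks at the cut points are the ends of the network at the cut points. -/
def sigmaEndsAtEquiv : (Σ i, (p.sub i).EndsAt (p.Qcut i)) ≃ N.EndsAt p.Pcut where
  toFun h := ⟨(h.2.1.1.1, h.2.1.2), p.Qcut_subset h.1 h.2.2⟩
  invFun h := ⟨p.part h.1.1, ⟨(⟨h.1.1, rfl⟩, h.1.2), p.mem_Qcut h.2⟩⟩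
  left_inv := by
    rintro ⟨i, ⟨⟨⟨j, hj⟩, b⟩, h⟩⟩
    subst hj
    rfl
  right_inv _ := rfl

/-- The functions of `W^{1,2}_{0,1}` on the network obtained by gluing admissible functions on the
subnetworks. -/
def glueSobolev : ((i : Fin l) → (p.sub i).sobolevSpace) →ₗ[ℝ] N.sobolevSpace :=
  (p.glueFun ∘ₗ LinearMap.pi fun i =>
    (p.sub i).sobolevSpace.subtype ∘ₗ LinearMap.proj i).codRestrict _ fun w =>
      p.mem_sobolev01_of_restrict fun i => by
        have := (w i).2
        rw [LinearMap.comp_apply, restrict_glueFun]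
        exact this

theorem restrict_glueSobolev (w : (i : Fin l) → (p.sub i).sobolevSpace) (i : Fin l) :
    p.restrict i (p.glueSobolev w).1 = (w i).1 :=
  p.restrict_glueFun (fun i => (w i).1) i

variable [Fintype ι]

theorem inner_eq_sum (g g' : N.V p.Pcut) :
    inner ℝ g g' = ∑ i, inner ℝ (p.res i g) (p.res i g') := by
  simp only [PiLp.inner_apply]
  rw [← p.sigmaEndsAtEquiv.sum_comp, Fintype.sum_sigma]
  rfl

variable {d : ι → ℝ → ℝ}

theorem form_eq_sum (u v : NetFun ι) : N.form d u v =
    ∑ i, (p.sub i).form (p.subPotential d i) (p.restrict i u) (p.restrict i v) :=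
  (Fintype.sum_fiberwise p.part fun j => (N.curve j).curveForm (d j) (u j) (v j)).symm

variable (d) in
/-- The functions of `W^{1,2}_{0,1}` which are smooth on each curve, solve `L u = 0`, and satisfy
the compatibility condition at the kept interior end points (but not necessarily at the cut
points). -/
def brokenSolutions : Submodule ℝ (smoothFun ι) :=
  N.sobolevSpace.comap (smoothFun ι).subtype ⊓
    ⨅ i, (LinearMap.ker ((p.sub i).opL (p.subPotential d i)) ⊓
      ((p.sub i).V2 (p.Psub i)).comap ((p.sub i).normalDeriv (p.Psub i))).comap
        (p.restrictSmooth i)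

theorem mem_brokenSolutions {u : smoothFun ι} : u ∈ p.brokenSolutions d ↔
    u.1 ∈ N.sobolev01 ∧ ∀ i, (p.sub i).opL (p.subPotential d i) (p.restrictSmooth i u) = 0 ∧
      (p.sub i).normalDeriv (p.Psub i) (p.restrictSmooth i u) ∈ (p.sub i).V2 (p.Psub i) := by
  simp only [brokenSolutions, Submodule.mem_inf, Submodule.mem_iInf, Submodule.mem_comap,
    LinearMap.mem_ker]
  rfl

/-- Green's formula for broken solutions: only the cut points contribute. -/
theorem form_brokenSolutions {u : smoothFun ι} (hu : u ∈ p.brokenSolutions d) {v : NetFun ι}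
    (hv : v ∈ N.sobolev01) :
    N.form d u.1 v = inner ℝ (N.normalDeriv p.Pcut u) (N.trace p.Pcut v) := by
  rw [p.form_eq_sum, p.inner_eq_sum]
  refine Finset.sum_congr rfl fun i _ => ?_
  obtain ⟨h1, h2⟩ := (p.mem_brokenSolutions.1 hu).2 i
  obtain ⟨h3, h4, h5⟩ := (p.mem_sobolev01_iff.1 hv).1 i
  exact (p.sub i).form_eq_inner_of_mem (S := p.Qcut i) subset_union_left h1 h2 h3 h4 h5

theorem mem_sumNeumannNull {x : N.V p.Pcut} :
    x ∈ p.sumNeumannNull d ↔ ∀ i, p.res i x ∈ p.subNeumannNull d i := by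
  simp [sumNeumannNull]

theorem mem_sumNeumannNullPerp {x : N.V p.Pcut} :
    x ∈ p.sumNeumannNullPerp d ↔ ∀ i, p.res i x ∈ (p.subNeumannNull d i)ᗮ := by
  simp [sumNeumannNullPerp]

theorem sumNeumannNullPerp_eq : p.sumNeumannNullPerp d = (p.sumNeumannNull d)ᗮ := by
  ext x
  rw [mem_sumNeumannNullPerp, Submodule.mem_orthogonal]
  constructor
  · intro h y hy
    rw [p.inner_eq_sum]
    exact Finset.sum_eq_zero fun i _ =>
      (Submodule.mem_orthogonal _ _).1 (h i) _ (p.mem_sumNeumannNull.1 hy i)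
  · intro h i
    rw [Submodule.mem_orthogonal]
    intro y hy
    have h1 : p.glue (Pi.single i y) ∈ p.sumNeumannNull d := by
      rw [mem_sumNeumannNull]
      intro k
      rw [res_glue]
      by_cases hk : k = i
      · subst hk
        rwa [Pi.single_eq_same]
      · rw [Pi.single_eq_of_ne hk]
        exact Submodule.zero_mem _
    have h2 := h _ h1
    rw [p.inner_eq_sum, Finset.sum_eq_single i] at h2
    · rwa [res_glue, Pi.single_eq_same] at h2
    · intro k _ hk
      rw [res_glue, Pi.single_eq_of_ne hk, inner_zero_left]
    · simp

theorem mem_sumNeumannNull_iff_brokenSolutions {x : N.V p.Pcut} : x ∈ p.sumNeumannNull d ↔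
    ∃ u ∈ p.brokenSolutions d, N.trace p.Pcut u.1 = 0 ∧ N.normalDeriv p.Pcut u = x := by
  rw [mem_sumNeumannNull]
  constructor
  · intro h
    choose w hw hwx using h
    obtain ⟨u, hu⟩ := p.exists_smooth_restrict_eq w
    have hu' : ∀ i, p.restrict i u.1 = (w i).1 := fun i => congrArg Subtype.val (hu i)
    have hmem : ∀ i, p.restrict i u.1 ∈ (p.sub i).sobolev01 := fun i => by
      obtain ⟨w1, w2, w3, w4⟩ := mem_nullSpace.1 (hw i)
      rw [hu' i]
      exact ⟨mem_sobolevFun_of_smooth (w i), w3, w2⟩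
    refine ⟨u, p.mem_brokenSolutions.2 ⟨p.mem_sobolev01_of_restrict hmem, fun i => ?_⟩,
      p.trace_eq_zero_of_restrict hmem, p.ext_res fun i => ?_⟩
    · obtain ⟨w1, w2, w3, w4⟩ := mem_nullSpace.1 (hw i)
      rw [hu i]
      exact ⟨w1, w4⟩
    · rw [res_normalDeriv, hu i]
      exact hwx i
  · rintro ⟨u, hu, h0, rfl⟩ i
    obtain ⟨hu1, hu2⟩ := p.mem_brokenSolutions.1 hu
    obtain ⟨h1, h2, h3⟩ := p.restrict_mem_sobolev01 hu1 h0 i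
    exact ⟨p.restrictSmooth i u, mem_nullSpace.2 ⟨(hu2 i).1, h3, h2, (hu2 i).2⟩, rfl⟩

theorem isDirichletToNeumann_subDN (hd : ∀ j, ContDiffOn ℝ ∞ (d j) (Icc 0 1)) (i : Fin l) :
    (p.sub i).IsDirichletToNeumann (p.subPotential d i) (p.Qcut i) (p.subDN d i) :=
  isDirichletToNeumann_dirichletToNeumann (N := p.sub i) (d := p.subPotential d i)
    (S := p.Qcut i) (fun j => hd j.1) subset_union_left

theorem res_hatT (g : p.sumNeumannNullPerp d) (i : Fin l) : p.res i (p.hatT d g) =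
    p.subDN d i ⟨p.res i g, p.mem_sumNeumannNullPerp.1 g.2 i⟩ := by
  rw [hatT, LinearMap.comp_apply, res_glue]
  rfl

/-- The elements of `V̄₁` are traces of broken solutions with Neumann data given by `T̂`. -/
theorem exists_brokenSolution_hatT (hd : ∀ j, ContDiffOn ℝ ∞ (d j) (Icc 0 1))
    (g : p.barV1 d) : ∃ u ∈ p.brokenSolutions d, N.trace p.Pcut u.1 = g ∧
      N.normalDeriv p.Pcut u = p.hatT d ⟨g, g.2.1⟩ := by
  have hgi := p.mem_sumNeumannNullPerp.1 g.2.1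
  choose w hw using fun i => (p.isDirichletToNeumann_subDN hd i ⟨_, hgi i⟩).1
  have hT := fun i => (p.isDirichletToNeumann_subDN hd i ⟨_, hgi i⟩).2 _ (hw i)
  obtain ⟨u, hu⟩ := p.exists_smooth_restrict_eq w
  have hu' : ∀ i, p.restrict i u.1 = (w i).1 := fun i => congrArg Subtype.val (hu i)
  have htr : N.trace p.Pcut u.1 = g := p.ext_res fun i => by
    rw [res_trace, hu' i]
    exact (hw i).2.1
  refine ⟨u, p.mem_brokenSolutions.2 ⟨p.mem_sobolev01_iff.2 ⟨fun i => ?_, ?_⟩, fun i => ?_⟩, htr,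
    p.ext_res fun i => ?_⟩
  · obtain ⟨w1, w2, w3, w4, w5, w6⟩ := hw i
    rw [hu' i]
    exact ⟨mem_sobolevFun_of_smooth (w i), w4, w3⟩
  · rw [htr]
    exact g.2.2
  · obtain ⟨w1, w2, w3, w4, w5, w6⟩ := hw i
    rw [hu i]
    exact ⟨w1, w5⟩
  · rw [res_normalDeriv, hu i, hT i]
    exact (p.res_hatT (d := d) ⟨g, g.2.1⟩ i).symm

theorem coe_barT (g : p.barV1 d) : (p.barT d g : N.V p.Pcut) =
    (p.barV1 d).starProjection (p.hatT d ⟨g, g.2.1⟩) := rfl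

theorem hatT_mem_orthogonal (g : p.sumNeumannNullPerp d) :
    p.hatT d g ∈ (p.sumNeumannNull d)ᗮ := by
  rw [← sumNeumannNullPerp_eq, mem_sumNeumannNullPerp]
  intro i
  rw [res_hatT]
  exact Subtype.mem _

/-! ### The index of a partitioned network -/

/-- The trace at the cut points, as a linear map on `W^{1,2}_{0,1}`. -/
def traceCut : N.sobolevSpace →ₗ[ℝ] N.V p.Pcut := N.trace p.Pcut ∘ₗ N.sobolevSpace.subtype

/-- The inclusion of the broken solutions into `W^{1,2}_{0,1}`. -/
def brokenInclusion : p.brokenSolutions d →ₗ[ℝ] N.sobolevSpace :=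
  ((smoothFun ι).subtype ∘ₗ (p.brokenSolutions d).subtype).codRestrict N.sobolevSpace
    fun z => (p.mem_brokenSolutions.1 z.2).1

/-- The Neumann data at the cut points of the broken solutions. -/
def brokenNormalDeriv : p.brokenSolutions d →ₗ[ℝ] N.V p.Pcut :=
  N.normalDeriv p.Pcut ∘ₗ (p.brokenSolutions d).subtype

/-- The index formula, for the indices in the sense of `HasMorseIndex`. -/
theorem hasMorseIndex (hd : ∀ j, ContDiffOn ℝ ∞ (d j) (Icc 0 1)) {n : Fin l → ℕ}
    (hn : ∀ i, HasMorseIndex ((p.sub i).formBilin (d := p.subPotential d i) fun j => hd j.1)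
      (n i)) :
    HasMorseIndex (N.formBilin hd)
      (∑ i, n i + p.indexBarT d + Module.finrank ℝ (p.F1 d)) := by
  choose φ hneg hmax using hn
  obtain ⟨φA, hφA⟩ : ∃ φA : ((i : Fin l) → Fin (n i) → ℝ) →ₗ[ℝ] N.sobolevSpace,
      ∀ a i, p.restrict i (φA a).1 = (φ i (a i)).1 :=
    ⟨p.glueSobolev ∘ₗ LinearMap.pi fun i => φ i ∘ₗ LinearMap.proj i,
      fun a i => p.restrict_glueSobolev _ i⟩
  have hAneg : ∀ a, a ≠ 0 → N.formBilin hd (φA a) (φA a) < 0 := by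
    intro a ha
    rw [formBilin_apply, p.form_eq_sum]
    simp only [hφA]
    have hle : ∀ i, (p.sub i).form (p.subPotential d i) (φ i (a i)).1 (φ i (a i)).1 ≤ 0 := by
      intro i
      by_cases h0 : a i = 0
      · have h1 : (p.sub i).formBilin (d := p.subPotential d i) (fun j => hd j.1)
            (φ i (a i)) (φ i (a i)) = 0 := by rw [h0, map_zero, map_zero]
        exact h1.le
      · exact (hneg i _ h0).le
    obtain ⟨i, hi⟩ := Function.ne_iff.1 ha
    exact Finset.sum_neg' (fun i _ => hle i) ⟨i, Finset.mem_univ i, hneg i _ hi⟩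
  have htr : ∀ h, p.traceCut h ∈ N.V1 p.Pcut := fun h => (p.mem_sobolev01_iff.1 h.2).2
  have hsurj : ∀ g ∈ N.V1 p.Pcut, ∃ h, p.traceCut h = g := fun g hg => by
    obtain ⟨u, hu, hug⟩ := p.exists_mem_sobolev01_trace_eq hg
    exact ⟨⟨u, hu⟩, hug⟩
  have hgreen : ∀ (z : p.brokenSolutions d) h, N.formBilin hd (p.brokenInclusion z) h =
      inner ℝ (p.brokenNormalDeriv z) (p.traceCut h) :=
    fun z h => p.form_brokenSolutions z.2 h.2
  have hD : ∀ x, x ∈ p.sumNeumannNull d ↔ ∃ z : p.brokenSolutions d,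
      p.traceCut (p.brokenInclusion z) = 0 ∧ p.brokenNormalDeriv z = x := fun x => by
    rw [p.mem_sumNeumannNull_iff_brokenSolutions]
    exact ⟨fun ⟨u, hu, h⟩ => ⟨⟨u, hu⟩, h⟩, fun ⟨z, h⟩ => ⟨z.1, z.2, h⟩⟩
  have hU' : ∀ x, x ∈ p.barV1 d ↔ x ∈ (p.sumNeumannNull d)ᗮ ∧ x ∈ N.V1 p.Pcut := fun x => by
    rw [barV1, sumNeumannNullPerp_eq, Submodule.mem_inf]
  have hT : ∀ g : p.barV1 d, ∃ z : p.brokenSolutions d,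
      p.traceCut (p.brokenInclusion z) = g ∧ ∀ g' : p.barV1 d,
        inner ℝ (p.brokenNormalDeriv z) (g' : N.V p.Pcut) = inner ℝ (p.barT d g) g' := fun g => by
    obtain ⟨u, hu, h1, h2⟩ := p.exists_brokenSolution_hatT hd g
    refine ⟨⟨u, hu⟩, h1, fun g' => ?_⟩
    have h3 : p.brokenNormalDeriv ⟨u, hu⟩ = p.hatT d ⟨g, g.2.1⟩ := h2
    rw [Submodule.coe_inner, coe_barT, h3, ← sub_eq_zero, ← inner_sub_left]
    exact Submodule.starProjection_inner_eq_zero _ _ g'.2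
  have hAtr : ∀ a, p.traceCut (φA a) = 0 := fun a =>
    p.trace_eq_zero_of_restrict fun i => (hφA a i).symm ▸ (φ i (a i)).2
  have hAmax : ∀ k : N.sobolevSpace, p.traceCut k = 0 →
      (∀ a, N.formBilin hd k (φA a) = 0) → 0 ≤ N.formBilin hd k k := by
    intro k hk hka
    rw [formBilin_apply, p.form_eq_sum]
    refine Finset.sum_nonneg fun i _ => ?_
    refine hmax i ⟨p.restrict i k.1, p.restrict_mem_sobolev01 k.2 hk i⟩ fun f => ?_
    have h1 := hka (Pi.single i f)
    rw [formBilin_apply, p.form_eq_sum, Finset.sum_eq_single i] at h1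
    · rwa [hφA, Pi.single_eq_same] at h1
    · intro i' _ hi'
      rw [hφA, Pi.single_eq_of_ne hi', map_zero]
      exact map_zero ((p.sub i').formBilin (d := p.subPotential d i') (fun j => hd j.1)
        ⟨p.restrict i' k.1, p.restrict_mem_sobolev01 k.2 hk i'⟩)
    · simp
  have main := hasMorseIndex_of_trace (A := (i : Fin l) → Fin (n i) → ℝ)
    (formBilin_comm hd) p.traceCut (N.V1 p.Pcut) htr hsurj (Z := p.brokenSolutions d)
  have key := main p.brokenInclusion p.brokenNormalDeriv hgreen (p.sumNeumannNull d) hD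
    (p.barV1 d) hU' (p.barT d) hT φA hAtr hAneg hAmax
  have hfin : Module.finrank ℝ ((i : Fin l) → Fin (n i) → ℝ) = ∑ i, n i := by
    rw [Module.finrank_pi_fintype]
    simp
  have hind : p.indexBarT d = Module.finrank ℝ (negEigenspace (p.barT d)) := rfl
  have hF1 : p.F1 d =
      p.sumNeumannNull d ⊓ (p.sumNeumannNull d ⊓ (N.V1 p.Pcut)ᗮ)ᗮ := rfl
  rw [hind, hF1, ← hfin]
  exact key

theorem F1_eq_of_split (h : p.sumNeumannNull d =
    (p.sumNeumannNull d ⊓ N.V1 p.Pcut) ⊔ (p.sumNeumannNull d ⊓ N.V2 p.Pcut)) :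
    p.F1 d = p.sumNeumannNull d ⊓ N.V1 p.Pcut := by
  ext x
  constructor
  · intro hx
    have hxD := hx.1
    rw [SetLike.mem_coe, h] at hxD
    obtain ⟨a, ha, b, hb, rfl⟩ := Submodule.mem_sup.1 hxD
    have h1 := (Submodule.mem_orthogonal _ _).1 hx.2 b hb
    rw [inner_add_right, (Submodule.mem_orthogonal' _ _).1 hb.2 a ha.2, zero_add] at h1
    rw [inner_self_eq_zero.1 h1, add_zero]
    exact ha
  · refine fun hx => ⟨hx.1, ?_⟩
    rw [SetLike.mem_coe, Submodule.mem_orthogonal]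
    exact fun y hy => (Submodule.mem_orthogonal' _ _).1 hy.2 x hx.2

theorem barT_eq_of_split (h : p.sumNeumannNull d =
    (p.sumNeumannNull d ⊓ N.V1 p.Pcut) ⊔ (p.sumNeumannNull d ⊓ N.V2 p.Pcut)) (g : p.barV1 d) :
    (p.barT d g : N.V p.Pcut) = (N.V1 p.Pcut).starProjection (p.hatT d ⟨g, g.2.1⟩) := by
  rw [coe_barT]
  set y := p.hatT d ⟨g, g.2.1⟩ with hy
  have hyD : y ∈ (p.sumNeumannNull d)ᗮ := p.hatT_mem_orthogonal _
  have hmem : (N.V1 p.Pcut).starProjection y ∈ N.V1 p.Pcut :=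
    Submodule.starProjection_apply_mem _ _
  refine Submodule.eq_starProjection_of_mem_of_inner_eq_zero ⟨?_, hmem⟩ fun w hw =>
    Submodule.starProjection_inner_eq_zero _ _ hw.2
  rw [SetLike.mem_coe, sumNeumannNullPerp_eq, Submodule.mem_orthogonal]
  intro x hx
  rw [h] at hx
  obtain ⟨a, ha, b, hb, rfl⟩ := Submodule.mem_sup.1 hx
  have h1 : inner ℝ a ((N.V1 p.Pcut).starProjection y) = 0 := by
    rw [← Submodule.inner_starProjection_left_eq_right,
      Submodule.starProjection_eq_self_iff.2 ha.2]
    exact (Submodule.mem_orthogonal _ _).1 hyD a ha.1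
  rw [inner_add_left, h1, (Submodule.mem_orthogonal' _ _).1 hb.2 _ hmem, add_zero]

end Partition

end Network

theorem mainTheorem2 {ι : Type*} [Fintype ι] (N : Network ι) {l : ℕ} (p : N.Partition l)
    (d : ι → ℝ → ℝ) (hd : ∀ j, ContDiffOn ℝ ∞ (d j) (Icc 0 1)) :
    (∀ i, (p.sub i).IsDirichletToNeumann (p.subPotential d i) (p.Qcut i) (p.subDN d i)) ∧
    N.index d ≠ ⊤ ∧
    N.index d = ∑ i, (p.sub i).index (p.subPotential d i) + (p.indexBarT d : ℕ∞) +
      (Module.finrank ℝ (p.F1 d) : ℕ∞) ∧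
    (p.sumNeumannNull d = (p.sumNeumannNull d ⊓ N.V1 p.Pcut) ⊔ (p.sumNeumannNull d ⊓ N.V2 p.Pcut) →
      p.F1 d = p.sumNeumannNull d ⊓ N.V1 p.Pcut ∧
      ∀ g : p.barV1 d, (p.barT d g : N.V p.Pcut) =
        (N.V1 p.Pcut).starProjection (p.hatT d ⟨g, g.2.1⟩)) := by
  choose n hn using fun i =>
    (p.sub i).exists_hasMorseIndex_formBilin (d := p.subPotential d i) fun j => hd j.1
  have hi : ∀ i, (p.sub i).index (p.subPotential d i) = n i := fun i =>
    Network.index_eq_of_hasMorseIndex (hn i)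
  have hN := Network.index_eq_of_hasMorseIndex (p.hasMorseIndex hd hn)
  refine ⟨p.isDirichletToNeumann_subDN hd, ?_, ?_,
    fun h => ⟨p.F1_eq_of_split h, p.barT_eq_of_split h⟩⟩
  · rw [hN]
    exact ENat.natCast_ne_top _
  · simp only [hN, hi]
    push_cast
    rfl

end
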